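/- **Conventions.** All manifolds are smooth, finite-dimensional, Hausdorff and second countable. Let $\zeta\colon Y\to M$ be a smooth locally trivial fibre bundle, $\mathcal{E}^0\subset J^k(\zeta)$ a differential equation, and $\mathcal{E}\subset J^\infty(\zeta)$ its infinite prolongation: the set of the jets $[s]^\infty_x$ of local sections such that $[s]^k_x\in\mathcal{E}^0$ and the graph of $j_k(s)$ is tangent to $\mathcal{E}^0$ to every order at $[s]^k_x$. Let $\xi\colon\mathcal{E}\to M$ be the projection. Smooth functions on $J^\infty(\zeta)$ are those that locally are smooth functions of finitely many jet coordinates; $C^\infty(\mathcal{E})$ consists of the functions that locally are restrictions of such functions. Vector fields are derivations, $D(N)=\mathrm{Der}\,C^\infty(N)$. The Cartan plane $\mathcal{C}_\theta$ at $\theta=[s]^\infty_x\in\mathcal{E}$ is the tangent plane to the graph of $j_\infty(s)$; $\mathcal{C}D$ is the module of the vector fields on $\mathcal{E}$ with values in these planes, and for $X\in D(M)$, $\mathcal{C}X$ denotes the lift of $X$ to the Cartan planes. For a bundle $N\to B$, $D(B,N)$ is the module of $C^\infty(N)$-valued derivations of $C^\infty(B)$; a connection is a $C^\infty(N)$-linear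 map $\nabla\colon D(B,N)\to D(N)$ with $(\nabla X)|_{C^\infty(B)}=X$; it is flat if $[\nabla X,\nabla Y]=\nabla[X,Y]$ for $X,Y\in D(B)$; its distribution is the image of $\nabla$. Put $Z\lrcorner\bar U_\nabla=\nabla(Z|_{C^\infty(B)})$ for $Z\in D(N)$. A symmetry of $N\to B$ with a distribution is a vector field on $N$ that vanishes on $C^\infty(B)$ and whose commutators with the fields of the distribution lie in the distribution. Let $\pi\colon E\to M$ be a smooth locally trivial fibre bundle, $\mathcal{E}'=\mathcal{E}\times_M E$ with projections $\tau\colon\mathcal{E}'\to\mathcal{E}$ and $\xi'\colon\mathcal{E}'\to E$; smooth functions on $\mathcal{E}'$ are those that locally are smooth functions of finitely many functions pulled back from $\mathcal{E}$ and $E$. Let $\mathcal{F}$ be a covering structure in $\tau$: a flat connection in $\pi\circ\xi'\colon\mathcal{E}'\to M$ with $\tau_*(\mathcal{F}X)=\mathcal{C}X$ for all $X\in D(M)$. Let $\mathcal{C}D_1=\tau_*^{-1}(\mathcal{C}D)$ be the module of the vector fields on $\mathcal{E}'$ whose values are projected by $\tau_*$ into the Cartan planes. **Theorem 5.1.** 1.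 There is a unique connection $\mathcal{C}_1$ in the bundle $\xi'\colon\mathcal{E}'\to E$ whose distribution is $\mathcal{C}D_1$. It is flat, so that $(\mathcal{E}',\mathcal{C}_1)$ is the trivially extended equation, with $E$ as the space of independent variables. The bundle $\pi$ and the connection $\mathcal{F}$ are a flat representation of $(\mathcal{E}',\mathcal{C}_1)$: $\mathcal{F}$ is a flat connection in $\pi\circ\xi'$, and $\mathcal{F}(X)\in\mathcal{C}D_1$ for every $X\in D(M)$. 2. Let $\mathcal{V}$ be the module of the $\pi\circ\xi'$-vertical fields in $\mathcal{C}D_1$, and consider the complex of the $\mathcal{V}$-valued horizontal forms on $\mathcal{E}'\to M$ with the differential $[\![\bar U_{\mathcal{F}},\cdot]\!]$ (Frölicher–Nijenhuis bracket). Let $S$ be a symmetry of $(\mathcal{E},\mathcal{C}D)$ over $M$. There is a unique $\xi'$-vertical vector field $\hat S$ on $\mathcal{E}'$ with $\tau_*(\hat S)=S$; it is a symmetry of $(\mathcal{E}',\mathcal{C}_1)$ over $E$, and $c_{\hat S}=[\![\bar U_{\mathcal{F}},\hat S]\!]$ is a $1$-cocycle of this complex. The cocycle $c_{\hat S}$ is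 exact, i.e. $c_{\hat S}=[\![\bar U_{\mathcal{F}},V]\!]$ for some $V\in\mathcal{V}$, if and only if there is a symmetry $S'\in D(\mathcal{E}')$ of the covering equation $(\mathcal{E}',\mathcal{F})$ over $M$ such that $\tau_*(S')=S$. -/

import Mathlib

open scoped Manifold ContDiff Topology

noncomputable section

namespace FlatRep

/-! # Vector fields, connections and flat representations in terms of function algebras

A (possibly infinite-dimensional) smooth space `N` enters through its algebra `A = C^∞(N)`; vector
fields on `N` are the derivations of `A`, i.e. the elements of `Derivation ℝ A A`. A map `N → B` is
given by the pullback homomorphism `φ : C^∞(B) →ₐ[ℝ] C^∞(N)`. -/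

section Algebra

variable {A B : Type*} [CommRing A] [Algebra ℝ A] [CommRing B] [Algebra ℝ B]

/-- `D(B, A)`: the `A`-module of `A`-valued derivations `X` of `B` along `φ`, i.e. `ℝ`-linear maps
with `X (f g) = f X(g) + g X(f)`. -/
def derAlong (φ : B →ₐ[ℝ] A) : Submodule A (B →ₗ[ℝ] A) where
  carrier := {X | ∀ f g : B, X (f * g) = φ f * X g + φ g * X f}
  add_mem' := by
    intro X Y hX hY f g
    simp only [Set.mem_ofPred_eq, LinearMap.add_apply] at *
    rw [hX, hY]; ring
  zero_mem' := by intro f g; simp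
  smul_mem' := by
    intro a X hX f g
    simp only [Set.mem_ofPred_eq, LinearMap.smul_apply, smul_eq_mul] at *
    rw [hX]; ring

/-- The module `D(B, A)` as a type. -/
def DerAlong (φ : B →ₐ[ℝ] A) : Type _ := derAlong φ

instance (φ : B →ₐ[ℝ] A) : AddCommGroup (DerAlong φ) := inferInstanceAs (AddCommGroup (derAlong φ))

instance (φ : B →ₐ[ℝ] A) : Module A (DerAlong φ) := inferInstanceAs (Module A (derAlong φ))

/-- The restriction `Y_B ∈ D(B, A)` of a vector field `Y ∈ D(A)` to the functions of the base. -/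
def restr (φ : B →ₐ[ℝ] A) : Derivation ℝ A A →ₗ[A] DerAlong φ where
  toFun Y := ⟨(Y : A →ₗ[ℝ] A) ∘ₗ φ.toLinearMap, by
    intro f g
    simp [Derivation.leibniz]⟩
  map_add' := fun _ _ => rfl
  map_smul' := fun _ _ => rfl

/-- A vector field `X` on the base, viewed as an element of `D(B, A)`. -/
def pullDer (φ : B →ₐ[ℝ] A) (X : Derivation ℝ B B) : DerAlong φ :=
  ⟨φ.toLinearMap ∘ₗ (X : B →ₗ[ℝ] B), by
    intro f g
    simp [Derivation.leibniz]⟩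

/-- The vertical vector fields: those that vanish on the functions of the base. -/
def vertical (φ : B →ₐ[ℝ] A) : Submodule A (Derivation ℝ A A) := LinearMap.ker (restr φ)

/-- A connection: an `A`-linear map `∇ : D(B, A) → D(A)` with `(∇ X)_B = X`. -/
structure Connection (φ : B →ₐ[ℝ] A) where
  /-- the horizontal lift -/
  toLin : DerAlong φ →ₗ[A] Derivation ℝ A A
  /-- a lift restricts to the vector that was lifted -/
  restr_toLin : ∀ X, restr φ (toLin X) = X

namespace Connection

variable {φ : B →ₐ[ℝ] A}

/-- The horizontal lift `∇ X ∈ D(A)` of a vector field `X ∈ D(B)` on the base. -/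
def lift (F : Connection φ) (X : Derivation ℝ B B) : Derivation ℝ A A := F.toLin (pullDer φ X)

/-- Flatness: `[∇ X, ∇ Y] = ∇ [X, Y]` for all vector fields `X`, `Y` on the base. -/
def IsFlat (F : Connection φ) : Prop :=
  ∀ X Y : Derivation ℝ B B, ⁅F.lift X, F.lift Y⁆ = F.lift ⁅X, Y⁆

/-- The distribution of the connection: the module of its horizontal vector fields. -/
def distribution (F : Connection φ) : Submodule A (Derivation ℝ A A) := LinearMap.range F.toLin

/-- The vector-valued `1`-form `Ū_∇ ∈ D(Λ¹)`, through its contractions `Z ⌟ Ū_∇ = ∇ (Z_B)`. -/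
def formU (F : Connection φ) : Derivation ℝ A A →ₗ[A] Derivation ℝ A A := F.toLin ∘ₗ restr φ

end Connection

/-- `S` is a (higher) symmetry of the space with distribution `𝒟` over the base of `φ`: it is
vertical, and `[S, Y]` lies in `𝒟` whenever `Y` does. -/
def IsSymmetry (φ : B →ₐ[ℝ] A) (𝒟 : Submodule A (Derivation ℝ A A)) (S : Derivation ℝ A A) :
    Prop :=
  S ∈ vertical φ ∧ ∀ Y ∈ 𝒟, ⁅S, Y⁆ ∈ 𝒟

/-- `F` is a flat representation of an equation with Cartan distribution `𝒟`: a flat connection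
over a further base (whose functions are pulled back by `φ`) with `F(X) ∈ 𝒟` for every vector field
`X` on that base. -/
def IsFlatRepresentation {φ : B →ₐ[ℝ] A} (𝒟 : Submodule A (Derivation ℝ A A))
    (F : Connection φ) : Prop :=
  F.IsFlat ∧ ∀ X : Derivation ℝ B B, F.lift X ∈ 𝒟

/-- The Frölicher–Nijenhuis bracket `⟦K, Y⟧` of a vector-valued `1`-form `K` (an `A`-linear
endomorphism `Z ↦ Z ⌟ K` of the vector fields) and a vector field `Y`:
`Z ⌟ ⟦K, Y⟧ = [Z ⌟ K, Y] - [Z, Y] ⌟ K`. -/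
def fnBracket (K : Derivation ℝ A A →ₗ[A] Derivation ℝ A A) (Y : Derivation ℝ A A) :
    Derivation ℝ A A →ₗ[A] Derivation ℝ A A where
  toFun Z := ⁅K Z, Y⁆ - K ⁅Z, Y⁆
  map_add' := by intro Z W; simp only [map_add, add_lie]; abel
  map_smul' := by
    intro a Z
    have h : ∀ W : Derivation ℝ A A, ⁅a • W, Y⁆ = a • ⁅W, Y⁆ - (Y a) • W := by
      intro W
      ext f
      simp only [Derivation.commutator_apply, Derivation.sub_apply, Derivation.smul_apply,
        smul_eq_mul, Derivation.leibniz]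
      ring
    simp only [map_smul, h, map_sub, RingHom.id_apply, smul_sub]
    abel

/-- The Frölicher–Nijenhuis bracket `⟦K, L⟧` of two vector-valued `1`-forms, evaluated on the
vector fields `X`, `Y`. -/
def fnBracket₂ (K L : Derivation ℝ A A →ₗ[A] Derivation ℝ A A) (X Y : Derivation ℝ A A) :
    Derivation ℝ A A :=
  ⁅K X, L Y⁆ - ⁅K Y, L X⁆ - L (⁅K X, Y⁆ - ⁅K Y, X⁆) - K (⁅L X, Y⁆ - ⁅L Y, X⁆)
    + (L (K ⁅X, Y⁆) + K (L ⁅X, Y⁆))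

/-- The `0`-cochains `𝒱` of the complex of a flat representation: the vertical fields in `𝒟`. -/
def zeroCochains (φ : B →ₐ[ℝ] A) (𝒟 : Submodule A (Derivation ℝ A A)) :
    Submodule A (Derivation ℝ A A) :=
  vertical φ ⊓ 𝒟

/-- The `1`-cochains: the horizontal `1`-forms with values in `𝒱`. -/
def IsOneCochain (φ : B →ₐ[ℝ] A) (𝒟 : Submodule A (Derivation ℝ A A))
    (c : Derivation ℝ A A →ₗ[A] Derivation ℝ A A) : Prop :=
  (∀ Z, c Z ∈ zeroCochains φ 𝒟) ∧ ∀ Z ∈ vertical φ, c Z = 0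

/-- The `1`-cocycles of the complex with differential `⟦Ū_F, ·⟧`. -/
def IsOneCocycle {φ : B →ₐ[ℝ] A} (𝒟 : Submodule A (Derivation ℝ A A)) (F : Connection φ)
    (c : Derivation ℝ A A →ₗ[A] Derivation ℝ A A) : Prop :=
  IsOneCochain φ 𝒟 c ∧ ∀ X Y, fnBracket₂ F.formU c X Y = 0

/-- Exactness of a `1`-form: it is `⟦Ū_F, V⟧` for some `0`-cochain `V`. -/
def IsExact {φ : B →ₐ[ℝ] A} (𝒟 : Submodule A (Derivation ℝ A A)) (F : Connection φ)
    (c : Derivation ℝ A A →ₗ[A] Derivation ℝ A A) : Prop :=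
  ∃ V ∈ zeroCochains φ 𝒟, c = fnBracket F.formU V

/-- The cocycle `c_S = ⟦Ū_F, S⟧` of a vector field `S`. -/
def symCocycle {φ : B →ₐ[ℝ] A} (F : Connection φ) (S : Derivation ℝ A A) :
    Derivation ℝ A A →ₗ[A] Derivation ℝ A A :=
  fnBracket F.formU S

end Algebra

/-! # Smooth functions generated by a set of functions -/

/-- The real functions on `X` that near every point (in the initial topology of `𝒢`) are smooth
functions of finitely many members of `𝒢`. -/
def generatedSmooth {X : Type*} (𝒢 : Set (X → ℝ)) : Subalgebra ℝ (X → ℝ) where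
  carrier := {f | ∀ x₀ : X, ∃ (N : ℕ) (g : Fin N → X → ℝ) (G : (Fin N → ℝ) → ℝ)
    (O : Set (Fin N → ℝ)), (∀ i, g i ∈ 𝒢) ∧ ContDiff ℝ ∞ G ∧ IsOpen O ∧ (fun i => g i x₀) ∈ O ∧
      ∀ x, (fun i => g i x) ∈ O → f x = G (fun i => g i x)}
  mul_mem' := by
    intro a b ha hb x₀
    obtain ⟨N, g, G, O, hg, hG, hO, hx, hf⟩ := ha x₀
    obtain ⟨N', g', G', O', hg', hG', hO', hx', hf'⟩ := hb x₀
    have e1 : ContDiff ℝ ∞ (fun v : Fin (N + N') → ℝ => fun i => v (Fin.castAdd N' i)) := by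
      fun_prop
    have e2 : ContDiff ℝ ∞ (fun v : Fin (N + N') → ℝ => fun i => v (Fin.natAdd N i)) := by
      fun_prop
    refine ⟨N + N', Fin.append g g', fun v => G (fun i => v (Fin.castAdd N' i)) *
      G' (fun i => v (Fin.natAdd N i)), (fun v => fun i => v (Fin.castAdd N' i)) ⁻¹' O ∩
      (fun v => fun i => v (Fin.natAdd N i)) ⁻¹' O', ?_, (hG.comp e1).mul (hG'.comp e2),
      (hO.preimage e1.continuous).inter (hO'.preimage e2.continuous), ?_, ?_⟩
    · intro i
      refine Fin.addCases (fun i => ?_) (fun i => ?_) i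
      · simpa using hg i
      · simpa using hg' i
    · simpa using ⟨hx, hx'⟩
    · intro x h
      simp only [Set.mem_inter_iff, Set.mem_preimage, Fin.append_left, Fin.append_right] at h
      simp [hf x h.1, hf' x h.2]
  add_mem' := by
    intro a b ha hb x₀
    obtain ⟨N, g, G, O, hg, hG, hO, hx, hf⟩ := ha x₀
    obtain ⟨N', g', G', O', hg', hG', hO', hx', hf'⟩ := hb x₀
    have e1 : ContDiff ℝ ∞ (fun v : Fin (N + N') → ℝ => fun i => v (Fin.castAdd N' i)) := by
      fun_prop
    have e2 : ContDiff ℝ ∞ (fun v : Fin (N + N') → ℝ => fun i => v (Fin.natAdd N i)) := by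
      fun_prop
    refine ⟨N + N', Fin.append g g', fun v => G (fun i => v (Fin.castAdd N' i)) +
      G' (fun i => v (Fin.natAdd N i)), (fun v => fun i => v (Fin.castAdd N' i)) ⁻¹' O ∩
      (fun v => fun i => v (Fin.natAdd N i)) ⁻¹' O', ?_, (hG.comp e1).add (hG'.comp e2),
      (hO.preimage e1.continuous).inter (hO'.preimage e2.continuous), ?_, ?_⟩
    · intro i
      refine Fin.addCases (fun i => ?_) (fun i => ?_) i
      · simpa using hg i
      · simpa using hg' i
    · simpa using ⟨hx, hx'⟩
    · intro x h
      simp only [Set.mem_inter_iff, Set.mem_preimage, Fin.append_left, Fin.append_right] at h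
      simp [hf x h.1, hf' x h.2]
  algebraMap_mem' := by
    intro r x₀
    exact ⟨0, Fin.elim0, fun _ => r, Set.univ, fun i => i.elim0, contDiff_const, isOpen_univ,
      trivial, fun x _ => rfl⟩

theorem mem_generatedSmooth {X : Type*} {𝒢 : Set (X → ℝ)} {f : X → ℝ} (hf : f ∈ 𝒢) :
    f ∈ generatedSmooth 𝒢 := fun _ =>
  ⟨1, fun _ => f, fun v => v 0, Set.univ, fun _ => hf, by fun_prop, isOpen_univ, trivial,
    fun _ _ => rfl⟩

/-! # Smooth fibre bundles, jets and infinitely prolonged equations -/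

/-- `C^∞(M)` for an `n`-dimensional manifold `M`. -/
abbrev Smooth (n : ℕ) (M : Type*) [TopologicalSpace M]
    [ChartedSpace (EuclideanSpace ℝ (Fin n)) M] : Type _ :=
  C^∞⟮𝓡 n, M; 𝓘(ℝ, ℝ), ℝ⟯

/-- `D(M)`: the vector fields on `M`. -/
abbrev VF (n : ℕ) (M : Type*) [TopologicalSpace M]
    [ChartedSpace (EuclideanSpace ℝ (Fin n)) M] : Type _ :=
  Derivation ℝ (Smooth n M) (Smooth n M)

/-- `p : Y → M` is a smooth locally trivial fibre bundle with typical fibre `F`. -/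
def IsSmoothFiberBundle (n d m : ℕ) {M Y : Type*} (F : Type*)
    [TopologicalSpace M] [ChartedSpace (EuclideanSpace ℝ (Fin n)) M]
    [TopologicalSpace Y] [ChartedSpace (EuclideanSpace ℝ (Fin d)) Y]
    [TopologicalSpace F] [ChartedSpace (EuclideanSpace ℝ (Fin m)) F] (p : Y → M) : Prop :=
  ContMDiff (𝓡 d) (𝓡 n) ∞ p ∧
    ∀ x : M, ∃ e : Bundle.Trivialization F p, x ∈ e.baseSet ∧
      ContMDiffOn (𝓡 d) ((𝓡 n).prod (𝓡 m)) ∞ e e.source ∧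
      ContMDiffOn ((𝓡 n).prod (𝓡 m)) (𝓡 d) ∞ e.toOpenPartialHomeomorph.symm e.target

section Jets

variable {n d : ℕ} {M Y : Type*}
  [TopologicalSpace M] [ChartedSpace (EuclideanSpace ℝ (Fin n)) M]
  [TopologicalSpace Y] [ChartedSpace (EuclideanSpace ℝ (Fin d)) Y]

open scoped Classical in
/-- A globally defined smooth function with the same germ at `x` as `g`
(which exists when `g` is smooth near `x`). -/
def localExt (g : M → ℝ) (x : M) : Smooth n M :=
  if h : ∃ f : Smooth n M, (f : M → ℝ) =ᶠ[𝓝 x] g then h.choose else 0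

/-- `(X₁ ⋯ X_j g)(x)` for vector fields `X₁, …, X_j` on `M` and a function `g` that is smooth
near `x` (but possibly not elsewhere). -/
def derivAt (Xs : List (VF n M)) (g : M → ℝ) (x : M) : ℝ :=
  (Xs.foldr (fun X f => X f) (localExt g x)) x

variable (n d)

/-- `s` is a smooth section of `p` on a neighbourhood of `x`. -/
def IsSectionNear (p : Y → M) (s : M → Y) (x : M) : Prop :=
  ∀ᶠ x' in 𝓝 x, p (s x') = x' ∧ ContMDiffAt (𝓡 n) (𝓡 d) ∞ s x'

/-- A point of `M` together with a local section of `p` near it. -/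
structure LocalSection (p : Y → M) where
  /-- the point -/
  pt : M
  /-- the section; its values away from `pt` are irrelevant -/
  sec : M → Y
  /-- it is a smooth section near the point -/
  isSection : IsSectionNear n d p sec pt

/-- Contact of order `k` (possibly `k = ∞`) of local sections at a common point `x`: for all
`f ∈ C^∞(Y)` the functions `f ∘ s` and `f ∘ s'` have the same derivatives of order `≤ k` at `x`. -/
def jetSetoid (p : Y → M) (k : ℕ∞) : Setoid (LocalSection n d p) where
  r a b := a.pt = b.pt ∧ ∀ (f : Smooth d Y) (Xs : List (VF n M)), (Xs.length : ℕ∞) ≤ k →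
    derivAt Xs (f ∘ a.sec) a.pt = derivAt Xs (f ∘ b.sec) b.pt
  iseqv :=
    ⟨fun _ => ⟨rfl, fun _ _ _ => rfl⟩, fun h => ⟨h.1.symm, fun f Xs l => (h.2 f Xs l).symm⟩,
      fun h h' => ⟨h.1.trans h'.1, fun f Xs l => (h.2 f Xs l).trans (h'.2 f Xs l)⟩⟩

/-- The space of jets `J^k(p)`; `k = ⊤` gives the infinite jets `J^∞(p)`. -/
def Jet (p : Y → M) (k : ℕ∞) : Type _ := Quotient (jetSetoid n d p k)

variable {n d}

/-- The jet `[s]_x^k`. -/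
def Jet.mk {p : Y → M} (k : ℕ∞) (a : LocalSection n d p) : Jet n d p k :=
  Quotient.mk (jetSetoid n d p k) a

/-- The projection `J^k(p) → M`, `[s]_x^k ↦ x`. -/
def Jet.base {p : Y → M} {k : ℕ∞} (θ : Jet n d p k) : M :=
  Quotient.lift (s := jetSetoid n d p k) LocalSection.pt (fun _ _ h => h.1) θ

/-- The function `[s]_x^k ↦ (X₁ ⋯ X_j (f ∘ s))(x)` on `J^k(p)`, `j ≤ k`; with `f` a coordinate of
`Y` and coordinate fields `X_i` these are the adapted coordinates. -/
def Jet.coord {p : Y → M} {k : ℕ∞} (f : Smooth d Y) (Xs : List (VF n M))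
    (h : (Xs.length : ℕ∞) ≤ k) (θ : Jet n d p k) : ℝ :=
  Quotient.lift (s := jetSetoid n d p k) (fun a => derivAt Xs (f ∘ a.sec) a.pt)
    (fun _ _ hab => hab.2 f Xs h) θ

/-- `C^∞(J^k(p))`: the functions that locally are smooth functions of finitely many (adapted)
coordinates. For `k = ⊤` they are locally of finite order. -/
def jetSmooth (p : Y → M) (k : ℕ∞) : Subalgebra ℝ (Jet n d p k → ℝ) :=
  generatedSmooth
    ({u | ∃ h : Smooth n M, u = fun θ => h θ.base} ∪
      {u | ∃ (f : Smooth d Y) (Xs : List (VF n M)) (h : (Xs.length : ℕ∞) ≤ k),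
        u = Jet.coord f Xs h})

open scoped Classical in
/-- The pullback `j_k(s)^* u : x ↦ u([s]_x^k)`, extended by zero. -/
def jetPull {p : Y → M} {k : ℕ∞} (u : Jet n d p k → ℝ) (s : M → Y) (x : M) : ℝ :=
  if h : IsSectionNear n d p s x then u (Jet.mk k ⟨x, s, h⟩) else 0

/-- The infinite prolongation `𝓔` of a differential equation `𝓔⁰ ⊆ J^k(p)`: the jets `[s]_x^∞`
such that `[s]_x^k ∈ 𝓔⁰` and the graph of `j_k(s)` is tangent to `𝓔⁰` with every order at
`[s]_x^k`, i.e. every smooth function that vanishes on `𝓔⁰` pulls back along `j_k(s)` to a function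
all of whose derivatives vanish at `x`. -/
def infProlong {p : Y → M} {k : ℕ} (E₀ : Set (Jet n d p (k : ℕ∞))) : Set (Jet n d p ⊤) :=
  {θ | ∃ a : LocalSection n d p, Jet.mk ⊤ a = θ ∧ Jet.mk (k : ℕ∞) a ∈ E₀ ∧
    ∀ u ∈ jetSmooth p (k : ℕ∞), (∀ ψ ∈ E₀, u ψ = 0) →
      ∀ Xs : List (VF n M), derivAt Xs (jetPull u a.sec) a.pt = 0}

variable {p : Y → M} {k : ℕ} (E₀ : Set (Jet n d p (k : ℕ∞)))

/-- The infinitely prolonged equation as a space. -/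
abbrev Eqn : Type _ := infProlong E₀

/-- `C^∞(𝓔)`: the functions that locally are restrictions of smooth functions on `J^∞(p)`. -/
def eqnSmooth : Subalgebra ℝ (Eqn E₀ → ℝ) :=
  generatedSmooth {f | ∃ u ∈ jetSmooth p ⊤, f = fun θ => u θ.1}

/-- `C^∞(𝓔)` as a type. -/
def EqnFun : Type _ := eqnSmooth E₀

instance : CommRing (EqnFun E₀) := inferInstanceAs (CommRing (eqnSmooth E₀))

instance : Algebra ℝ (EqnFun E₀) := inferInstanceAs (Algebra ℝ (eqnSmooth E₀))

/-- The restriction to `𝓔` of a smooth function on `J^∞(p)`. -/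
def restrictEqn (u : jetSmooth (n := n) (d := d) p ⊤) : EqnFun E₀ :=
  ⟨fun θ => u.1 θ.1, mem_generatedSmooth ⟨u.1, u.2, rfl⟩⟩

/-- `ξ^* : C^∞(M) → C^∞(𝓔)` for the projection `ξ : 𝓔 → M`. -/
def xiStar : Smooth n M →ₐ[ℝ] EqnFun E₀ where
  toFun h := restrictEqn E₀ ⟨fun θ => h θ.base, mem_generatedSmooth (Or.inl ⟨h, rfl⟩)⟩
  map_one' := rfl
  map_mul' _ _ := rfl
  map_zero' := rfl
  map_add' _ _ := rfl
  commutes' _ := rfl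

/-- `v`, a tangent vector to `𝓔` at `θ = [s]_x^∞` (given by its action on `C^∞(𝓔)`), is the value at
`θ` of the Cartan lift `𝒞X`: it is the image of `X_x` under the differential of `j_∞(s)`. -/
def IsCartanLiftAt (X : VF n M) (θ : Eqn E₀) (v : EqnFun E₀ → ℝ) : Prop :=
  ∀ a : LocalSection n d p, Jet.mk ⊤ a = θ.1 → ∀ u : jetSmooth (n := n) (d := d) p ⊤,
    v (restrictEqn E₀ u) = derivAt [X] (jetPull u.1 a.sec) a.pt

/-- `v` lies in the Cartan plane `𝒞_θ`, the tangent plane at `θ = [s]_x^∞` to the graph of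
`j_∞(s)`. -/
def InCartanPlane (θ : Eqn E₀) (v : EqnFun E₀ → ℝ) : Prop :=
  ∃ X : VF n M, IsCartanLiftAt E₀ X θ v

theorem inCartanPlane_zero (θ : Eqn E₀) : InCartanPlane E₀ θ (fun _ => 0) :=
  ⟨0, fun a _ u => by simp [derivAt]⟩

theorem InCartanPlane.add {θ : Eqn E₀} {v w : EqnFun E₀ → ℝ} (hv : InCartanPlane E₀ θ v)
    (hw : InCartanPlane E₀ θ w) : InCartanPlane E₀ θ (fun f => v f + w f) := by
  obtain ⟨X, hX⟩ := hv
  obtain ⟨X', hX'⟩ := hw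
  exact ⟨X + X', fun a ha u => by
    simp only [hX a ha u, hX' a ha u]
    simp [derivAt]⟩

theorem InCartanPlane.smul {θ : Eqn E₀} {v : EqnFun E₀ → ℝ} (c : ℝ)
    (hv : InCartanPlane E₀ θ v) : InCartanPlane E₀ θ (fun f => c * v f) := by
  obtain ⟨X, hX⟩ := hv
  exact ⟨c • X, fun a ha u => by
    simp only [hX a ha u]
    simp [derivAt]⟩

/-- The vector fields on `𝓔` that lie in the Cartan distribution. -/
def cartanDistribution : Submodule (EqnFun E₀) (Derivation ℝ (EqnFun E₀) (EqnFun E₀)) where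
  carrier := {Z | ∀ θ : Eqn E₀, InCartanPlane E₀ θ (fun f => (Z f).1 θ)}
  add_mem' := fun hZ hW θ => (hZ θ).add E₀ (hW θ)
  zero_mem' := fun θ => inCartanPlane_zero E₀ θ
  smul_mem' := fun a _ hZ θ => (hZ θ).smul E₀ (a.1 θ)

/-! # The pullback of a bundle `π : E → M` to the equation, and coverings -/

variable {e : ℕ} {E : Type*} [TopologicalSpace E] [ChartedSpace (EuclideanSpace ℝ (Fin e)) E]
  (π : E → M)

/-- The pullback `𝓔' = ξ^*(E) = 𝓔 ×_M E`. -/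
abbrev Pullback : Type _ := {q : Eqn E₀ × E // q.1.1.base = π q.2}

variable (e)

/-- `C^∞(𝓔')`: the functions that locally are smooth functions of finitely many functions
pulled back from `𝓔` and `E`. -/
def pullbackSmooth : Subalgebra ℝ (Pullback E₀ π → ℝ) :=
  generatedSmooth
    ({f | ∃ u ∈ eqnSmooth E₀, f = fun q => u q.1.1} ∪
      {f | ∃ g : Smooth e E, f = fun q => g q.1.2})

/-- `C^∞(𝓔')` as a type. -/
def PullbackFun : Type _ := pullbackSmooth E₀ e π

instance : CommRing (PullbackFun E₀ e π) := inferInstanceAs (CommRing (pullbackSmooth E₀ e π))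

instance : Algebra ℝ (PullbackFun E₀ e π) :=
  inferInstanceAs (Algebra ℝ (pullbackSmooth E₀ e π))

/-- `τ^* : C^∞(𝓔) → C^∞(𝓔')` for the projection `τ : 𝓔' → 𝓔`. -/
def tauStar : EqnFun E₀ →ₐ[ℝ] PullbackFun E₀ e π where
  toFun u := ⟨fun q => u.1 q.1.1, mem_generatedSmooth (Or.inl ⟨u.1, u.2, rfl⟩)⟩
  map_one' := rfl
  map_mul' _ _ := rfl
  map_zero' := rfl
  map_add' _ _ := rfl
  commutes' _ := rfl

/-- `ξ'^* : C^∞(E) → C^∞(𝓔')` for the projection `ξ' : 𝓔' → E`. -/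
def xiStar' : Smooth e E →ₐ[ℝ] PullbackFun E₀ e π where
  toFun g := ⟨fun q => g q.1.2, mem_generatedSmooth (Or.inr ⟨g, rfl⟩)⟩
  map_one' := rfl
  map_mul' _ _ := rfl
  map_zero' := rfl
  map_add' _ _ := rfl
  commutes' _ := rfl

/-- `η^* : C^∞(M) → C^∞(𝓔')` for the composition `η = π ∘ ξ' = ξ ∘ τ : 𝓔' → M`. -/
def etaStar : Smooth n M →ₐ[ℝ] PullbackFun E₀ e π := (tauStar E₀ e π).comp (xiStar E₀)

/-- `F` is a covering structure in `τ : 𝓔' → 𝓔`: a flat connection in `η : 𝓔' → M` with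
`τ_* (F X) = 𝒞X` for every vector field `X` on `M`. -/
def IsCovering (F : Connection (etaStar E₀ e π)) : Prop :=
  F.IsFlat ∧ ∀ (X : VF n M) (q : Pullback E₀ π),
    IsCartanLiftAt E₀ X q.1.1 (fun f => (F.lift X (tauStar E₀ e π f)).1 q)

/-- The distribution `τ_*⁻¹(𝒞D)` on `𝓔'`: the vector fields whose values are projected by `τ_*`
into the Cartan planes of `𝓔`. -/
def extendedDistribution : Submodule (PullbackFun E₀ e π)
    (Derivation ℝ (PullbackFun E₀ e π) (PullbackFun E₀ e π)) where
  carrier := {Z | ∀ q : Pullback E₀ π,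
    InCartanPlane E₀ q.1.1 (fun f => (Z (tauStar E₀ e π f)).1 q)}
  add_mem' := fun hZ hW q => (hZ q).add E₀ (hW q)
  zero_mem' := fun q => inCartanPlane_zero E₀ q.1.1
  smul_mem' := fun a _ hZ q => (hZ q).smul E₀ (a.1 q)

variable {e}

/-- `τ_* Z = S`: the vector field `Z` on `𝓔'` projects to the vector field `S` on `𝓔`. -/
def ProjectsTo (Z : Derivation ℝ (PullbackFun E₀ e π) (PullbackFun E₀ e π))
    (S : Derivation ℝ (EqnFun E₀) (EqnFun E₀)) : Prop :=
  ∀ f : EqnFun E₀, Z (tauStar E₀ e π f) = tauStar E₀ e π (S f)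

/-- `Z = Ŝ`: the canonical lift of a `ξ`-vertical vector field `S` on `𝓔` to `𝓔' = 𝓔 ×_M E`, i.e.
the `ξ'`-vertical vector field that projects to `S`. -/
def IsHat (S : Derivation ℝ (EqnFun E₀) (EqnFun E₀))
    (Z : Derivation ℝ (PullbackFun E₀ e π) (PullbackFun E₀ e π)) : Prop :=
  Z ∈ vertical (xiStar' E₀ e π) ∧ ProjectsTo E₀ π Z S

end Jets

end FlatRep

end

open FlatRep

/-! A tangent vector to `𝓔'` is determined by its action on the functions pulled back from `𝓔` and
from `E`. If `τ_*` maps it into a Cartan plane, its action on `𝓔` is determined by its projection to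
`M`, and functions on `M` are also functions on `E`. Hence restriction to `C^∞(E)` is injective on
the extended distribution (`eq_of_mem_extendedDistribution`). It is also onto `D(E, 𝓔')`: the part
of a derivation over `M` is lifted by `F`, and the remainder is `π`-vertical, so on the fibre
product it extends to a `τ`-vertical field (`exists_vertical_extension`). The inverse of this
bijection is the connection over `E`.

Its flatness comes from the involutivity of the extended distribution, which is generated locally by
the lifts `F X` and the `τ`-vertical fields `V`. Here `[F X, F X'] = F [X, X']`. The field `[F X,
V]` is `τ`-vertical because `F X` maps functions pulled back from `𝓔` to functions constant along
the fibres of `τ`, and these are again pulled back (`exists_tauStar_eq`). That `Ŝ` is a symmetry is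
checked on the same generators.

Flatness of `F` makes the Nijenhuis torsion of `Ū_F` vanish, so `⟦Ū_F, Ŝ⟧` is closed by the graded
Jacobi identity. The symmetries of `(𝓔', F)` over `M` are the vertical fields that commute with
`Ū_F` (`Connection.isSymmetry_iff`), and `𝒱` consists of the `τ`-vertical fields. So the lifts of
`S` vertical over `M` are the fields `Ŝ - V` with `V ∈ 𝒱`, and `Ŝ - V` is a symmetry exactly when
`⟦Ū_F, Ŝ⟧ = ⟦Ū_F, V⟧`.

The analysis rests on point derivations of function algebras. They are local and, by Hadamard's
lemma, obey the chain rule, so vector fields can be compared and constructed pointwise on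
generators. Localization is multiplication by a function `ρ` that does not vanish at the point. -/

namespace FlatRep

/-! ### Hadamard's lemma -/

section Hadamard

open MeasureTheory

variable {V : Type} [NormedAddCommGroup V] [NormedSpace ℝ V] [FiniteDimensional ℝ V]

/-- The derivative in `x` is continuous, hence bounded on the product of `[0, 1]` with the closed
unit ball about `x₀`; this bound is the dominating function. -/
theorem hasFDerivAt_integral_of_contDiff {W : Type} [NormedAddCommGroup W] [NormedSpace ℝ W]
    [CompleteSpace W] {f : ℝ × V → W} (hf : ContDiff ℝ ∞ f) (x₀ : V) :
    HasFDerivAt (fun x => ∫ t in (0 : ℝ)..1, f (t, x))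
      (∫ t in (0 : ℝ)..1, (fderiv ℝ f (t, x₀)).comp (ContinuousLinearMap.inr ℝ ℝ V)) x₀ := by
  have hc : Continuous fun y : ℝ × V =>
      (fderiv ℝ f y).comp (ContinuousLinearMap.inr ℝ ℝ V) :=
    (hf.continuous_fderiv (by simp)).clm_comp continuous_const
  obtain ⟨C, hC⟩ := (((isCompact_Icc (a := (0 : ℝ)) (b := 1)).prod
    (isCompact_closedBall x₀ 1)).bddAbove_image hc.norm.continuousOn)
  refine (intervalIntegral.hasFDerivAt_integral_of_dominated_of_fderiv_le
    (F' := fun x t => (fderiv ℝ f (t, x)).comp (ContinuousLinearMap.inr ℝ ℝ V))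
    (bound := fun _ => C) (Metric.closedBall_mem_nhds x₀ one_pos) ?_ ?_ ?_ ?_ ?_ ?_)
  · exact Filter.Eventually.of_forall fun x =>
      (hf.continuous.comp (by fun_prop : Continuous fun t : ℝ => (t, x))).aestronglyMeasurable
  · exact (hf.continuous.comp (by fun_prop : Continuous fun t : ℝ => (t, x₀))).intervalIntegrable _ _
  · exact (hc.comp (by fun_prop : Continuous fun t : ℝ => (t, x₀))).aestronglyMeasurable
  · refine Filter.Eventually.of_forall fun t ht x hx => hC ⟨(t, x), ⟨?_, hx⟩, rfl⟩
    rw [Set.uIoc_of_le zero_le_one] at ht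
    exact ⟨ht.1.le, ht.2⟩
  · exact intervalIntegrable_const
  · refine Filter.Eventually.of_forall fun t _ x _ => ?_
    have h1 : HasFDerivAt f (fderiv ℝ f (t, x)) (t, x) :=
      (hf.differentiable (by simp) _).hasFDerivAt
    exact h1.comp x (hasFDerivAt_prodMk_right t x)

/-- The derivative is an integral of the same kind with values in a space of linear maps, so the
induction on the order runs over all `W` at once. -/
theorem contDiff_integral_of_contDiff {W : Type} [NormedAddCommGroup W] [NormedSpace ℝ W]
    [CompleteSpace W] {f : ℝ × V → W} (hf : ContDiff ℝ ∞ f) :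
    ContDiff ℝ ∞ fun x => ∫ t in (0 : ℝ)..1, f (t, x) := by
  refine contDiff_infty.2 fun k => ?_
  induction k generalizing W with
  | zero =>
    exact contDiff_zero.2 (continuous_iff_continuousAt.2 fun x =>
      (hasFDerivAt_integral_of_contDiff hf x).continuousAt)
  | succ k ih =>
    push_cast
    refine contDiff_succ_iff_hasFDerivAt.2 ⟨_, ih (f := fun y =>
      (fderiv ℝ f y).comp (ContinuousLinearMap.inr ℝ ℝ V)) ?_, hasFDerivAt_integral_of_contDiff hf⟩
    exact (hf.fderiv_right (m := ∞) (by simp)).clm_comp contDiff_const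

/-- **Hadamard's lemma**. -/
theorem exists_hadamard {ι : Type} [Fintype ι] [DecidableEq ι] {G : (ι → ℝ) → ℝ}
    (hG : ContDiff ℝ ∞ G) (v₀ : ι → ℝ) :
    ∃ H : ι → (ι → ℝ) → ℝ, (∀ i, ContDiff ℝ ∞ (H i)) ∧
      (∀ i, H i v₀ = fderiv ℝ G v₀ (Pi.single i 1)) ∧
      ∀ v, G v = G v₀ + ∑ i, (v i - v₀ i) * H i v := by
  have hG' : ContDiff ℝ ∞ (fderiv ℝ G) := hG.fderiv_right (by simp)
  have hs : ∀ i : ι, ContDiff ℝ ∞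
      fun y : ℝ × (ι → ℝ) => fderiv ℝ G (v₀ + y.1 • (y.2 - v₀)) (Pi.single i 1) := fun i =>
    (hG'.comp (by fun_prop)).clm_apply contDiff_const
  -- The fundamental theorem of calculus along the segment from `v₀` to `v`: the coefficients are
  -- the means of the partial derivatives.
  refine ⟨fun i v => ∫ t in (0 : ℝ)..1, fderiv ℝ G (v₀ + t • (v - v₀)) (Pi.single i 1),
    fun i => contDiff_integral_of_contDiff (hs i), fun i => by simp, fun v => ?_⟩
  have hd : ∀ t : ℝ, HasDerivAt (fun t : ℝ => G (v₀ + t • (v - v₀)))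
      (∑ i, (v i - v₀ i) * fderiv ℝ G (v₀ + t • (v - v₀)) (Pi.single i 1)) t := by
    intro t
    have h1 : HasDerivAt (fun t : ℝ => v₀ + t • (v - v₀)) (v - v₀) t := by
      simpa using ((hasDerivAt_id t).smul_const (v - v₀)).const_add v₀
    have h2 := ((hG.differentiable (by simp) _).hasFDerivAt (x := v₀ + t • (v - v₀))).comp_hasDerivAt
      t h1
    refine h2.congr_deriv ?_
    conv_lhs => rw [pi_eq_sum_univ' (v - v₀), map_sum]
    refine Finset.sum_congr rfl fun i _ => ?_
    rw [← pi_eq_sum_univ', map_smul, smul_eq_mul, Pi.sub_apply]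
  have hi : ∀ i ∈ Finset.univ, IntervalIntegrable
      (fun t : ℝ => (v i - v₀ i) * fderiv ℝ G (v₀ + t • (v - v₀)) (Pi.single i 1)) volume 0 1 :=
    fun i _ => (((hs i).continuous.comp
      (by fun_prop : Continuous fun t : ℝ => (t, v))).const_mul _).intervalIntegrable _ _
  have h3 := intervalIntegral.integral_eq_sub_of_hasDerivAt (a := 0) (b := 1)
    (fun t _ => hd t) (by
      simpa only [Finset.sum_fn] using IntervalIntegrable.sum Finset.univ hi)
  rw [intervalIntegral.integral_finsetSum hi] at h3
  simp only [intervalIntegral.integral_const_mul, one_smul, zero_smul, add_sub_cancel,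
    add_zero] at h3
  rw [h3]; ring

end Hadamard

/-! # Algebras of smooth functions on a set and their point derivations -/

section FunctionAlgebras

variable {X A : Type*} [CommRing A] [Algebra ℝ A]

/-- The filter of the sets that contain `{y | ρ y ≠ 0}` for a function `ρ` of the algebra with
`ρ x ≠ 0`. -/
def nearFilter (ev : A →ₐ[ℝ] (X → ℝ)) (x : X) : Filter X where
  sets := {s | ∃ ρ : A, ev ρ x ≠ 0 ∧ ∀ y, ev ρ y ≠ 0 → y ∈ s}
  univ_sets := ⟨1, by simp, fun _ _ => trivial⟩
  sets_of_superset := fun ⟨ρ, h, hs⟩ hst => ⟨ρ, h, fun y hy => hst (hs y hy)⟩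
  inter_sets := by
    rintro s t ⟨ρ, h, hs⟩ ⟨ρ', h', ht⟩
    refine ⟨ρ * ρ', by simpa using ⟨h, h'⟩, fun y hy => ?_⟩
    simp only [map_mul, Pi.mul_apply, ne_eq, mul_eq_zero, not_or] at hy
    exact ⟨hs y hy.1, ht y hy.2⟩

theorem eventually_nearFilter {ev : A →ₐ[ℝ] (X → ℝ)} {x : X} {P : X → Prop} :
    (∀ᶠ y in nearFilter ev x, P y) ↔ ∃ ρ : A, ev ρ x ≠ 0 ∧ ∀ y, ev ρ y ≠ 0 → P y := Iff.rfl

theorem self_of_nearFilter {ev : A →ₐ[ℝ] (X → ℝ)} {x : X} {P : X → Prop}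
    (h : ∀ᶠ y in nearFilter ev x, P y) : P x := by
  obtain ⟨ρ, h1, h2⟩ := eventually_nearFilter.1 h
  exact h2 x h1

/-- The sets `{ρ ≠ 0}` act as open sets: each is near all of its points. -/
theorem eventually_eventually_nearFilter {ev : A →ₐ[ℝ] (X → ℝ)} {x : X} {P : X → Prop}
    (h : ∀ᶠ y in nearFilter ev x, P y) :
    ∀ᶠ y in nearFilter ev x, ∀ᶠ z in nearFilter ev y, P z := by
  obtain ⟨ρ, h1, h2⟩ := eventually_nearFilter.1 h
  exact eventually_nearFilter.2 ⟨ρ, h1, fun y hy => eventually_nearFilter.2 ⟨ρ, hy, h2⟩⟩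

theorem tendsto_nearFilter {X' A' : Type*} [CommRing A'] [Algebra ℝ A']
    {ev : A →ₐ[ℝ] (X → ℝ)} {ev' : A' →ₐ[ℝ] (X' → ℝ)} {φ : A' →ₐ[ℝ] A} {p : X → X'}
    (h : ∀ f x, ev (φ f) x = ev' f (p x)) (x : X) :
    Filter.Tendsto p (nearFilter ev x) (nearFilter ev' (p x)) := by
  rintro s ⟨ρ, h1, h2⟩
  exact ⟨φ ρ, by rwa [h], fun y hy => h2 _ (by rwa [h] at hy)⟩

/-- `A` is (the algebra of the smooth functions of) a differential space: an algebra of functions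
closed under composition with smooth functions of several variables and under localization. -/
structure IsDifferentialSpace (ev : A →ₐ[ℝ] (X → ℝ)) : Prop where
  injective : Function.Injective ev
  exists_comp : ∀ {N : ℕ} (g : Fin N → A) {G : (Fin N → ℝ) → ℝ}, ContDiff ℝ ∞ G →
    ∃ f : A, ∀ x, ev f x = G fun i => ev (g i) x
  exists_of_local : ∀ f : X → ℝ, (∀ x, ∃ a : A, ∀ᶠ y in nearFilter ev x, f y = ev a y) →
    ∃ a : A, ev a = f

/-- Near every point, the functions of the algebra are smooth functions of members of `𝒢`. -/
def Generates (ev : A →ₐ[ℝ] (X → ℝ)) (𝒢 : Set A) : Prop :=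
  ∀ (f : A) (x : X), ∃ (N : ℕ) (g : Fin N → A) (G : (Fin N → ℝ) → ℝ), (∀ i, g i ∈ 𝒢) ∧
    ContDiff ℝ ∞ G ∧ ∀ᶠ y in nearFilter ev x, ev f y = G fun i => ev (g i) y

/-- `δ` is a derivation at the point `x`. -/
structure IsPointDer (ev : A →ₐ[ℝ] (X → ℝ)) (x : X) (δ : A → ℝ) : Prop where
  map_add : ∀ f g, δ (f + g) = δ f + δ g
  map_smul : ∀ (c : ℝ) f, δ (c • f) = c * δ f
  leibniz : ∀ f g, δ (f * g) = ev f x * δ g + ev g x * δ f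

variable {ev : A →ₐ[ℝ] (X → ℝ)} {x : X} {δ δ' : A → ℝ}

theorem IsDifferentialSpace.exists_comp_fintype (hev : IsDifferentialSpace ev) {ι : Type}
    [Fintype ι] (g : ι → A) {G : (ι → ℝ) → ℝ} (hG : ContDiff ℝ ∞ G) :
    ∃ f : A, ∀ x, ev f x = G fun i => ev (g i) x := by
  let e := Fintype.equivFin ι
  obtain ⟨f, hf⟩ := hev.exists_comp (fun j => g (e.symm j)) (G := fun v => G fun i => v (e i))
    (hG.comp (by fun_prop))
  exact ⟨f, fun x => by simp [hf]⟩

/-- A bump function supported in `O`, composed with `g`, is a member of the algebra that can serve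
as `ρ`. -/
theorem IsDifferentialSpace.eventually_mem (hev : IsDifferentialSpace ev) {ι : Type}
    [Fintype ι] (g : ι → A) {O : Set (ι → ℝ)} (hO : IsOpen O) (hx : (fun i => ev (g i) x) ∈ O) :
    ∀ᶠ y in nearFilter ev x, (fun i => ev (g i) y) ∈ O := by
  obtain ⟨G, hs, -, hG, -, h1⟩ := exists_contDiff_tsupport_subset (n := ⊤) (hO.mem_nhds hx)
  obtain ⟨ρ, hρ⟩ := hev.exists_comp_fintype g hG
  refine eventually_nearFilter.2 ⟨ρ, by simp [hρ, h1], fun y hy => hs (subset_tsupport _ ?_)⟩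
  simpa [hρ] using hy

namespace IsPointDer

theorem map_zero (hδ : IsPointDer ev x δ) : δ 0 = 0 := by
  simpa using hδ.map_smul 0 0

theorem map_one (hδ : IsPointDer ev x δ) : δ 1 = 0 := by
  simpa using hδ.leibniz 1 1

theorem map_algebraMap (hδ : IsPointDer ev x δ) (c : ℝ) : δ (algebraMap ℝ A c) = 0 := by
  rw [Algebra.algebraMap_eq_smul_one, hδ.map_smul, hδ.map_one, mul_zero]

theorem map_sub (hδ : IsPointDer ev x δ) (f g : A) : δ (f - g) = δ f - δ g := by
  have := hδ.map_add (f - g) g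
  rw [sub_add_cancel] at this
  linarith

theorem map_sum (hδ : IsPointDer ev x δ) {ι : Type*} (s : Finset ι) (f : ι → A) :
    δ (∑ i ∈ s, f i) = ∑ i ∈ s, δ (f i) := by
  classical
  induction s using Finset.induction_on with
  | empty => simpa using hδ.map_zero
  | insert i s hi ih => rw [Finset.sum_insert hi, Finset.sum_insert hi, hδ.map_add, ih]

theorem zero : IsPointDer ev x (fun _ => 0) where
  map_add f g := by simp
  map_smul c f := by simp
  leibniz f g := by simp

/-- Point derivations are local. -/
theorem congr (hδ : IsPointDer ev x δ) (hev : IsDifferentialSpace ev) {f f' : A}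
    (h : ∀ᶠ y in nearFilter ev x, ev f y = ev f' y) : δ f = δ f' := by
  have hx := self_of_nearFilter h
  obtain ⟨ρ, h1, h2⟩ := eventually_nearFilter.1 h
  -- Multiplication by `ρ` turns equality near `x` into equality in the algebra. Since `f` and `f'`
  -- agree at `x`, the Leibniz rule leaves `ρ(x) δ f = ρ(x) δ f'`.
  have h3 : ρ * f = ρ * f' := hev.injective <| funext fun y => by
    by_cases hy : ev ρ y = 0
    · simp [hy]
    · simp [h2 y hy]
  have h4 := congrArg δ h3
  rw [hδ.leibniz, hδ.leibniz, hx] at h4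
  exact mul_left_cancel₀ h1 (by linarith)

/-- In the Hadamard expansion of `G` at the value of `g` at `x`, the derivation kills the constant,
and as `g i - g i(x)` vanishes at `x` only `k i(x) δ (g i)` survives, where `k i(x)` is the partial
derivative. -/
theorem comp_of_forall (hδ : IsPointDer ev x δ) (hev : IsDifferentialSpace ev) {ι : Type}
    [Fintype ι] [DecidableEq ι] {f : A} {g : ι → A} {G : (ι → ℝ) → ℝ} (hG : ContDiff ℝ ∞ G)
    (hf : ∀ y, ev f y = G fun i => ev (g i) y) :
    δ f = ∑ i, fderiv ℝ G (fun i => ev (g i) x) (Pi.single i 1) * δ (g i) := by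
  obtain ⟨H, hH, hH0, hGH⟩ := exists_hadamard hG (fun i => ev (g i) x)
  choose k hk using fun i => hev.exists_comp_fintype g (hH i)
  have h1 : f = algebraMap ℝ A (G fun i => ev (g i) x) +
      ∑ i, (g i - algebraMap ℝ A (ev (g i) x)) * k i := hev.injective <| funext fun y => by
    rw [hf, hGH]
    simp [hk, Finset.sum_apply]
  rw [h1, hδ.map_add, hδ.map_algebraMap, hδ.map_sum, zero_add]
  refine Finset.sum_congr rfl fun i _ => ?_
  rw [hδ.leibniz, hδ.map_sub, hδ.map_algebraMap, hk, hH0]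
  simp

/-- The chain rule. -/
theorem comp (hδ : IsPointDer ev x δ) (hev : IsDifferentialSpace ev) {ι : Type}
    [Fintype ι] [DecidableEq ι] {f : A} {g : ι → A} {G : (ι → ℝ) → ℝ} (hG : ContDiff ℝ ∞ G)
    (hf : ∀ᶠ y in nearFilter ev x, ev f y = G fun i => ev (g i) y) :
    δ f = ∑ i, fderiv ℝ G (fun i => ev (g i) x) (Pi.single i 1) * δ (g i) := by
  obtain ⟨f', hf'⟩ := hev.exists_comp_fintype g hG
  rw [hδ.congr hev (f' := f') (hf.mono fun y hy => by rw [hy, hf']), hδ.comp_of_forall hev hG hf']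

/-- A point derivation is determined by its values on generators. -/
theorem ext_of_generates (hδ : IsPointDer ev x δ) (hδ' : IsPointDer ev x δ')
    (hev : IsDifferentialSpace ev) {𝒢 : Set A} (h𝒢 : Generates ev 𝒢)
    (h : ∀ g ∈ 𝒢, δ g = δ' g) (f : A) : δ f = δ' f := by
  obtain ⟨N, g, G, hg, hG, hf⟩ := h𝒢 f x
  rw [hδ.comp hev hG hf, hδ'.comp hev hG hf]
  exact Finset.sum_congr rfl fun i _ => by rw [h _ (hg i)]

end IsPointDer

theorem IsPointDer.of_derivation (Z : Derivation ℝ A A) (x : X) :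
    IsPointDer ev x (fun f => ev (Z f) x) where
  map_add f g := by simp
  map_smul c f := by simp
  leibniz f g := by simp

theorem IsPointDer.comap {X' A' : Type*} [CommRing A'] [Algebra ℝ A'] {ev' : A' →ₐ[ℝ] (X' → ℝ)}
    (hδ : IsPointDer ev x δ) (φ : A' →ₐ[ℝ] A) {x' : X'} (h : ∀ f, ev (φ f) x = ev' f x') :
    IsPointDer ev' x' (fun f => δ (φ f)) where
  map_add f g := by rw [_root_.map_add, hδ.map_add]
  map_smul c f := by rw [_root_.map_smul, hδ.map_smul]
  leibniz f g := by rw [map_mul, hδ.leibniz, h, h]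

theorem IsPointDer.of_derAlong {X' A' : Type*} [CommRing A'] [Algebra ℝ A']
    {ev' : A' →ₐ[ℝ] (X' → ℝ)} {φ : A' →ₐ[ℝ] A} (Z : DerAlong φ) {x' : X'}
    (h : ∀ f, ev (φ f) x = ev' f x') : IsPointDer ev' x' (fun f => ev (Z.1 f) x) where
  map_add f g := by simp
  map_smul c f := by simp
  leibniz f g := by
    rw [show Z.1 (f * g) = φ f * Z.1 g + φ g * Z.1 f from Z.2 f g]
    simp [h]

/-- A field of point derivations that maps the functions to smooth functions is a derivation. -/
theorem IsDifferentialSpace.exists_derivation (hev : IsDifferentialSpace ev) {δ : X → A → ℝ}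
    (hδ : ∀ x, IsPointDer ev x (δ x))
    (h : ∀ f x, ∃ a : A, ∀ᶠ y in nearFilter ev x, δ y f = ev a y) :
    ∃ Z : Derivation ℝ A A, ∀ f x, ev (Z f) x = δ x f := by
  choose Z hZ using fun f => hev.exists_of_local (fun x => δ x f) (h f)
  refine ⟨Derivation.mk' ⟨⟨Z, fun f g => hev.injective ?_⟩, fun c f => hev.injective ?_⟩
    fun f g => hev.injective ?_, fun f x => congrFun (hZ f) x⟩
  · funext x; simp [hZ, (hδ x).map_add]
  · funext x; simp [hZ, (hδ x).map_smul]
  · funext x; simp [hZ, (hδ x).leibniz]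

/-- Where `f` is `G` of generators, the chain rule writes `δ y f` as a finite sum of products of
smooth functions of `y`. It is applied at every `y` near `x`, hence the iterated eventuality. -/
theorem IsDifferentialSpace.exists_derivation_of_generates (hev : IsDifferentialSpace ev)
    {𝒢 : Set A} (h𝒢 : Generates ev 𝒢) {δ : X → A → ℝ} (hδ : ∀ x, IsPointDer ev x (δ x))
    (h : ∀ g ∈ 𝒢, ∃ a : A, ∀ y, δ y g = ev a y) :
    ∃ Z : Derivation ℝ A A, ∀ f x, ev (Z f) x = δ x f := by
  refine hev.exists_derivation hδ fun f x => ?_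
  obtain ⟨N, g, G, hg, hG, hf⟩ := h𝒢 f x
  choose a ha using fun i => h (g i) (hg i)
  choose k hk using fun i : Fin N => hev.exists_comp g
    (G := fun v => fderiv ℝ G v (Pi.single i 1))
    ((hG.fderiv_right (m := ∞) (by simp)).clm_apply contDiff_const)
  refine ⟨∑ i, k i * a i, (eventually_eventually_nearFilter hf).mono fun y hy => ?_⟩
  rw [(hδ y).comp hev hG hy]
  simp [hk, ha]

theorem derivation_ext_of_generates (hev : IsDifferentialSpace ev) {𝒢 : Set A}
    (h𝒢 : Generates ev 𝒢) {Z W : Derivation ℝ A A} (h : ∀ g ∈ 𝒢, Z g = W g) : Z = W :=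
  Derivation.ext fun f => hev.injective <| funext fun x =>
    (IsPointDer.of_derivation Z x).ext_of_generates (.of_derivation W x) hev h𝒢
      (fun g hg => by rw [h g hg]) f

end FunctionAlgebras

/-! ### Generated function algebras are differential spaces -/

section GeneratedSmooth

variable {X : Type*} {𝒢 : Set (X → ℝ)}

theorem mem_generatedSmooth_of_fintype {f : X → ℝ}
    (h : ∀ x₀ : X, ∃ (ι : Type) (_ : Fintype ι) (g : ι → X → ℝ) (G : (ι → ℝ) → ℝ)
      (O : Set (ι → ℝ)), (∀ i, g i ∈ 𝒢) ∧ ContDiff ℝ ∞ G ∧ IsOpen O ∧ (fun i => g i x₀) ∈ O ∧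
        ∀ x, (fun i => g i x) ∈ O → f x = G (fun i => g i x)) : f ∈ generatedSmooth 𝒢 := by
  intro x₀
  obtain ⟨ι, _, g, G, O, hg, hG, hO, hx, hf⟩ := h x₀
  let e := Fintype.equivFin ι
  have he : ContDiff ℝ ∞ fun (v : Fin (Fintype.card ι) → ℝ) i => v (e i) := by fun_prop
  refine ⟨_, fun j => g (e.symm j), fun v => G fun i => v (e i), (fun v i => v (e i)) ⁻¹' O,
    fun j => hg _, hG.comp he, hO.preimage he.continuous, by simpa using hx, fun x h => ?_⟩
  simpa using hf x (by simpa using h)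

/-- The local expressions of the `g i` are substituted in `G`; the result depends on the disjoint
union of their generators. -/
theorem comp_mem_generatedSmooth {N : ℕ} {g : Fin N → X → ℝ} (hg : ∀ i, g i ∈ generatedSmooth 𝒢)
    {G : (Fin N → ℝ) → ℝ} (hG : ContDiff ℝ ∞ G) :
    (fun x => G fun i => g i x) ∈ generatedSmooth 𝒢 := by
  refine mem_generatedSmooth_of_fintype fun x₀ => ?_
  choose n k K O hk hK hO hx h using fun i => hg i x₀
  have he : ∀ i, ContDiff ℝ ∞ fun (v : (Σ i, Fin (n i)) → ℝ) j => v ⟨i, j⟩ := fun i => by fun_prop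
  refine ⟨Σ i, Fin (n i), inferInstance, fun j => k j.1 j.2,
    fun v => G fun i => K i fun j => v ⟨i, j⟩, ⋂ i, (fun v j => v ⟨i, j⟩) ⁻¹' O i,
    fun j => hk _ _, hG.comp (contDiff_pi.2 fun i => (hK i).comp (he i)),
    isOpen_iInter_of_finite fun i => (hO i).preimage (he i).continuous,
    Set.mem_iInter.2 fun i => hx i, fun x hx' => ?_⟩
  congr 1
  funext i
  exact h i x (Set.mem_iInter.1 hx' i)

/-- Near the point `ρ` is itself a smooth function `G'` of generators, so `ρ ≠ 0` becomes an open
condition on finitely many of them, to be added to the domain of the expression for `a`. -/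
theorem mem_generatedSmooth_of_local {f : X → ℝ} (h : ∀ x, ∃ a ∈ generatedSmooth 𝒢,
    ∃ ρ ∈ generatedSmooth 𝒢, ρ x ≠ 0 ∧ ∀ y, ρ y ≠ 0 → f y = a y) : f ∈ generatedSmooth 𝒢 := by
  refine mem_generatedSmooth_of_fintype fun x₀ => ?_
  obtain ⟨a, ha, ρ, hρ, h1, h2⟩ := h x₀
  obtain ⟨N, g, G, O, hg, hG, hO, hx, hf⟩ := ha x₀
  obtain ⟨N', g', G', O', hg', hG', hO', hx', hf'⟩ := hρ x₀
  have e1 : ContDiff ℝ ∞ (fun v : Fin N ⊕ Fin N' → ℝ => fun i => v (Sum.inl i)) := by fun_prop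
  have e2 : ContDiff ℝ ∞ (fun v : Fin N ⊕ Fin N' → ℝ => fun i => v (Sum.inr i)) := by fun_prop
  refine ⟨Fin N ⊕ Fin N', inferInstance, Sum.elim g g', fun v => G fun i => v (Sum.inl i),
    (fun v i => v (Sum.inl i)) ⁻¹' O ∩ ((fun v i => v (Sum.inr i)) ⁻¹' (O' ∩ G' ⁻¹' {0}ᶜ)),
    ?_, hG.comp e1, (hO.preimage e1.continuous).inter
      ((hO'.inter (isOpen_compl_singleton.preimage hG'.continuous)).preimage e2.continuous),
    ⟨by simpa using hx, by simpa using hx', ?_⟩, fun x hx => ?_⟩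
  · rintro (i | i)
    exacts [hg i, hg' i]
  · simpa [hf' x₀ hx'] using h1
  · simp only [Set.mem_inter_iff, Set.mem_preimage, Sum.elim_inl, Sum.elim_inr] at hx
    rw [h2 x (by rw [hf' x hx.2.1]; exact hx.2.2), hf x hx.1]
    simp

theorem isDifferentialSpace_generatedSmooth :
    IsDifferentialSpace (generatedSmooth 𝒢).val where
  injective := Subtype.val_injective
  exists_comp g _ hG := ⟨⟨_, comp_mem_generatedSmooth (fun i => (g i).2) hG⟩, fun _ => rfl⟩
  exists_of_local f hf := by
    refine ⟨⟨f, mem_generatedSmooth_of_local fun x => ?_⟩, rfl⟩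
    obtain ⟨a, ha⟩ := hf x
    obtain ⟨ρ, h1, h2⟩ := eventually_nearFilter.1 ha
    exact ⟨a.1, a.2, ρ.1, ρ.2, h1, h2⟩

theorem generates_generatedSmooth :
    Generates (generatedSmooth 𝒢).val {f | f.1 ∈ 𝒢} := by
  intro f x
  obtain ⟨N, g, G, O, hg, hG, hO, hx, hf⟩ := f.2 x
  refine ⟨N, fun i => ⟨g i, mem_generatedSmooth (hg i)⟩, G, hg, hG, ?_⟩
  exact (isDifferentialSpace_generatedSmooth.eventually_mem
    (fun i => ⟨g i, mem_generatedSmooth (hg i)⟩) hO hx).mono fun y hy => hf y hy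

end GeneratedSmooth

/-! ### Smooth functions and tangent vectors on manifolds -/

section Manifolds

section Extension

variable {V H N : Type*} [NormedAddCommGroup V] [NormedSpace ℝ V] [FiniteDimensional ℝ V]
  [TopologicalSpace H] {I : ModelWithCorners ℝ V H} [TopologicalSpace N] [ChartedSpace H N]
  [IsManifold I ∞ N] [T2Space N]

/-- Multiply `g` by a bump function at `x` whose closed support lies where `g` is smooth. -/
theorem exists_contMDiff_eventuallyEq {g : N → ℝ} {x : N}
    (hg : ∀ᶠ y in 𝓝 x, ContMDiffAt I 𝓘(ℝ, ℝ) ∞ g y) :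
    ∃ f : N → ℝ, ContMDiff I 𝓘(ℝ, ℝ) ∞ f ∧ f =ᶠ[𝓝 x] g := by
  obtain ⟨ρ, -, hρ⟩ := (SmoothBumpFunction.nhds_basis_tsupport (I := I) x).mem_iff.1 hg
  refine ⟨fun y => ρ y * g y, contMDiff_of_tsupport fun y hy => ?_, ?_⟩
  · exact ρ.contMDiffAt.mul (hρ (closure_mono (Function.support_mul_subset_left _ _) hy))
  · filter_upwards [ρ.eventuallyEq_one] with y hy
    simp [hy]

end Extension

variable {n : ℕ} {M : Type*}
  [TopologicalSpace M] [ChartedSpace (EuclideanSpace ℝ (Fin n)) M]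

theorem localExt_eventuallyEq {g : M → ℝ} {x : M}
    (h : ∃ f : Smooth n M, (f : M → ℝ) =ᶠ[𝓝 x] g) : (localExt (n := n) g x : M → ℝ) =ᶠ[𝓝 x] g := by
  rw [localExt, dif_pos h]
  exact h.choose_spec

variable (n M) in
/-- The values of the smooth functions on a manifold. -/
noncomputable def smoothEv : Smooth n M →ₐ[ℝ] (M → ℝ) where
  toFun f := f
  map_one' := rfl
  map_mul' _ _ := rfl
  map_zero' := rfl
  map_add' _ _ := rfl
  commutes' _ := rfl

@[simp]
theorem smoothEv_apply (f : Smooth n M) (x : M) : smoothEv n M f x = f x := rfl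

/-- In local coordinates `Φ` with inverse `Ψ`, a smooth function is a smooth function of the
coordinates. -/
theorem exists_eq_comp_coordinates {ι : Type} [Fintype ι] {Φ : M → ι → ℝ} {Ψ : (ι → ℝ) → M}
    {x : M} (hΦ : ContinuousAt Φ x)
    (hΨ : ∀ᶠ v in 𝓝 (Φ x), ContMDiffAt 𝓘(ℝ, ι → ℝ) (𝓡 n) ∞ Ψ v)
    (h : ∀ᶠ y in 𝓝 x, Ψ (Φ y) = y) (f : Smooth n M) :
    ∃ G : (ι → ℝ) → ℝ, ContDiff ℝ ∞ G ∧ G =ᶠ[𝓝 (Φ x)] f ∘ Ψ ∧ ∀ᶠ y in 𝓝 x, f y = G (Φ y) := by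
  obtain ⟨G, hG, hGf⟩ := exists_contMDiff_eventuallyEq (I := 𝓘(ℝ, ι → ℝ)) (g := f ∘ Ψ)
    (x := Φ x) (hΨ.mono fun v hv => f.contMDiff.contMDiffAt.comp v hv)
  refine ⟨G, hG.contDiff, hGf, ?_⟩
  filter_upwards [hΦ.eventually hGf, h] with y h1 h2
  rw [h1, Function.comp_apply, h2]

variable [IsManifold (𝓡 n) ∞ M] [T2Space M]

theorem exists_smooth_eventuallyEq {g : M → ℝ} {x : M}
    (hg : ∀ᶠ y in 𝓝 x, ContMDiffAt (𝓡 n) 𝓘(ℝ, ℝ) ∞ g y) :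
    ∃ f : Smooth n M, (f : M → ℝ) =ᶠ[𝓝 x] g := by
  obtain ⟨f, hf, h⟩ := exists_contMDiff_eventuallyEq hg
  exact ⟨⟨f, hf⟩, h⟩

/-- Bump functions give one inequality, continuity of smooth functions the other. Algebraic
localization is thus the topological one on a manifold. -/
theorem nearFilter_smoothEv (x : M) : nearFilter (smoothEv n M) x = 𝓝 x := by
  refine le_antisymm (fun s hs => ?_) fun s hs => ?_
  · obtain ⟨ρ, -, hρ⟩ := (SmoothBumpFunction.nhds_basis_tsupport (I := 𝓡 n) x).mem_iff.1 hs
    exact ⟨⟨ρ, ρ.contMDiff⟩, ρ.eq_one.trans_ne one_ne_zero, fun y hy => hρ (subset_tsupport _ hy)⟩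
  · obtain ⟨ρ, h1, h2⟩ := hs
    exact Filter.mem_of_superset
      ((isOpen_compl_singleton.preimage ρ.contMDiff.continuous).mem_nhds h1) h2

variable (n M) in
theorem isDifferentialSpace_smoothEv : IsDifferentialSpace (smoothEv n M) where
  injective := DFunLike.coe_injective
  exists_comp g G hG :=
    ⟨⟨fun x => G fun i => g i x, hG.contMDiff.comp (contMDiff_pi_space.2 fun i => (g i).contMDiff)⟩,
      fun _ => rfl⟩
  exists_of_local f hf := by
    refine ⟨⟨f, fun x => ?_⟩, rfl⟩
    obtain ⟨a, ha⟩ := hf x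
    rw [nearFilter_smoothEv] at ha
    exact a.contMDiff.contMDiffAt.congr_of_eventuallyEq ha

theorem IsPointDer.congr_nhds {x : M} {δ : Smooth n M → ℝ} (hδ : IsPointDer (smoothEv n M) x δ)
    {f f' : Smooth n M} (h : (f : M → ℝ) =ᶠ[𝓝 x] f') : δ f = δ f' :=
  hδ.congr (isDifferentialSpace_smoothEv n M) (by rw [nearFilter_smoothEv]; exact h)

/-- `derivAt` uses a chosen extension of the germ; locality of derivations makes the choice
irrelevant. -/
theorem derivAt_singleton (X : VF n M) {g : M → ℝ} {x : M} {f : Smooth n M}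
    (h : (f : M → ℝ) =ᶠ[𝓝 x] g) : derivAt [X] g x = X f x :=
  (IsPointDer.of_derivation (ev := smoothEv n M) X x).congr_nhds
    ((localExt_eventuallyEq ⟨f, h⟩).trans h.symm)

/-- Near every point there are coordinate functions `h i` and vector fields `X i` such that the
tangent vectors are `∑ δ (h i) X i`. -/
theorem exists_local_frame (x₀ : M) : ∃ (h : Fin n → Smooth n M) (X : Fin n → VF n M),
    ∀ᶠ x in 𝓝 x₀, ∀ δ, IsPointDer (smoothEv n M) x δ → ∀ f, δ f = ∑ i, δ (h i) * X i f x := by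
  let φ := chartAt (EuclideanSpace ℝ (Fin n)) x₀
  let Φ : M → Fin n → ℝ := fun x => (EuclideanSpace.equiv (Fin n) ℝ) (φ x)
  let Ψ : (Fin n → ℝ) → M := fun v => φ.symm ((EuclideanSpace.equiv (Fin n) ℝ).symm v)
  have hΨΦ : ∀ x ∈ φ.source, Ψ (Φ x) = x := fun x hx => by
    simp only [Φ, Ψ, ContinuousLinearEquiv.symm_apply_apply, φ.left_inv hx]
  have hΦ : ∀ x ∈ φ.source, ContMDiffAt (𝓡 n) 𝓘(ℝ, Fin n → ℝ) ∞ Φ x := fun x hx =>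
    (EuclideanSpace.equiv (Fin n) ℝ).contDiff.contMDiff.contMDiffAt.comp x
      ((contMDiffOn_chart (I := 𝓡 n) (x := x₀) x hx).contMDiffAt (φ.open_source.mem_nhds hx))
  have hT : IsOpen ((EuclideanSpace.equiv (Fin n) ℝ).symm ⁻¹' φ.target) :=
    φ.open_target.preimage (EuclideanSpace.equiv (Fin n) ℝ).symm.continuous
  have hΨ : ∀ v ∈ (EuclideanSpace.equiv (Fin n) ℝ).symm ⁻¹' φ.target,
      ContMDiffAt 𝓘(ℝ, Fin n → ℝ) (𝓡 n) ∞ Ψ v := fun v hv =>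
    ((contMDiffOn_chart_symm (I := 𝓡 n) (x := x₀) _ hv).contMDiffAt
      (φ.open_target.mem_nhds hv)).comp v
      (EuclideanSpace.equiv (Fin n) ℝ).symm.contDiff.contMDiff.contMDiffAt
  have hmem : ∀ x ∈ φ.source, Φ x ∈ (EuclideanSpace.equiv (Fin n) ℝ).symm ⁻¹' φ.target :=
    fun x hx => by simpa [Φ] using φ.map_source hx
  have hf : ∀ (f : Smooth n M), ∀ v ∈ (EuclideanSpace.equiv (Fin n) ℝ).symm ⁻¹' φ.target,
      ContDiffAt ℝ ∞ (f ∘ Ψ) v := fun f v hv =>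
    (f.contMDiff.contMDiffAt.comp v (hΨ v hv)).contDiffAt
  have hx₀ : x₀ ∈ φ.source := mem_chart_source _ _
  choose h hh using fun i : Fin n => exists_smooth_eventuallyEq (n := n) (x := x₀)
    (g := fun x => Φ x i) (Filter.eventually_of_mem (φ.open_source.mem_nhds hx₀) fun x hx =>
      contMDiffAt_pi_space.1 (hΦ x hx) i)
  obtain ⟨ρ⟩ : Nonempty (SmoothBumpFunction (𝓡 n) x₀) := inferInstance
  -- The coordinate fields cut off by a bump function, so that they extend by zero to `M`. Near
  -- `x₀`, where `ρ` is `1`, they are the coordinate fields themselves.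
  let D : Fin n → M → Smooth n M → ℝ := fun i x f =>
    ρ x * fderiv ℝ (f ∘ Ψ) (Φ x) (Pi.single i 1)
  have hD : ∀ i x, IsPointDer (smoothEv n M) x (D i x) := by
    intro i x
    by_cases hx : x ∈ φ.source
    · have hd : ∀ f : Smooth n M, DifferentiableAt ℝ (f ∘ Ψ) (Φ x) := fun f =>
        (hf f _ (hmem x hx)).differentiableAt (by simp)
      refine ⟨fun f g => ?_, fun c f => ?_, fun f g => ?_⟩
      · have : (⇑(f + g) : M → ℝ) ∘ Ψ = f ∘ Ψ + g ∘ Ψ := rfl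
        simp only [D, this, fderiv_add (hd f) (hd g), add_apply]
        ring
      · have : (⇑(c • f) : M → ℝ) ∘ Ψ = c • (f ∘ Ψ) := rfl
        simp only [D, this, fderiv_const_smul (hd f), smul_apply,
          smul_eq_mul]
        ring
      · have : (⇑(f * g) : M → ℝ) ∘ Ψ = (f ∘ Ψ) * (g ∘ Ψ) := rfl
        simp only [D, this, fderiv_mul (hd f) (hd g), add_apply,
          smul_apply, smul_eq_mul, Function.comp_apply, hΨΦ x hx, smoothEv_apply]
        ring
    · have : ρ x = 0 := by
        by_contra h0
        exact hx (ρ.support_subset_source h0)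
      simpa [D, this] using IsPointDer.zero
  have hX : ∀ i, ∃ X : VF n M, ∀ f x, smoothEv n M (X f) x = D i x f := fun i => by
    refine (isDifferentialSpace_smoothEv n M).exists_derivation (hD i) fun f x => ?_
    rw [nearFilter_smoothEv]
    by_cases hx : x ∈ tsupport ρ
    · have hs : ∀ᶠ y in 𝓝 x, y ∈ φ.source :=
        φ.open_source.mem_nhds (ρ.tsupport_subset_chartAt_source hx)
      obtain ⟨a, ha⟩ := exists_smooth_eventuallyEq (n := n) (x := x) (g := fun y => D i y f)
        (hs.mono fun y hy => ρ.contMDiffAt.mul (by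
          have h1 : ContDiffAt ℝ ∞ (fun v => fderiv ℝ (f ∘ Ψ) v (Pi.single i 1)) (Φ y) :=
            ((hf f _ (hmem y hy)).fderiv_right (m := ∞) (by simp)).clm_apply contDiffAt_const
          exact h1.contMDiffAt.comp y (hΦ y hy)))
      exact ⟨a, ha.symm⟩
    · refine ⟨0, ?_⟩
      filter_upwards [(isClosed_tsupport ρ).isOpen_compl.mem_nhds hx] with y hy
      simp [D, image_eq_zero_of_notMem_tsupport hy]
  choose X hX using hX
  refine ⟨h, X, ?_⟩
  have hh' : ∀ᶠ x in 𝓝 x₀, ∀ᶠ y in 𝓝 x, ∀ i, h i y = Φ y i :=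
    eventually_eventually_nhds.2 (Filter.eventually_all.2 hh)
  filter_upwards [hh', ρ.eventuallyEq_one, φ.open_source.mem_nhds hx₀] with x h1 h2 h3 δ hδ f
  obtain ⟨G, hG, hGf, hfG⟩ := exists_eq_comp_coordinates (hΦ x h3).continuousAt
    (Filter.eventually_of_mem (hT.mem_nhds (hmem x h3)) hΨ)
    (Filter.eventually_of_mem (φ.open_source.mem_nhds h3) hΨΦ) f
  rw [hδ.comp (isDifferentialSpace_smoothEv n M) (g := h) hG ?_]
  · refine Finset.sum_congr rfl fun i _ => ?_
    have h4 : (fun i => smoothEv n M (h i) x) = Φ x := funext fun i => h1.self_of_nhds i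
    rw [h4, hGf.fderiv_eq, ← smoothEv_apply (X i f), hX]
    simp [D, h2, mul_comm]
  · rw [nearFilter_smoothEv]
    filter_upwards [hfG, h1] with y h5 h6
    rw [smoothEv_apply, h5]
    congr 1
    exact funext fun i => (h6 i).symm

end Manifolds

/-! ### Local sections and fibre retractions of bundles -/

section Bundles

variable {n e r : ℕ} {M E Q : Type*}
  [TopologicalSpace M] [ChartedSpace (EuclideanSpace ℝ (Fin n)) M]
  [TopologicalSpace E] [ChartedSpace (EuclideanSpace ℝ (Fin e)) E]
  [TopologicalSpace Q] [ChartedSpace (EuclideanSpace ℝ (Fin r)) Q]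
  {π : E → M}

/-- The pullback of functions along a smooth map. -/
noncomputable def pullbackHom (hπ : ContMDiff (𝓡 e) (𝓡 n) ∞ π) : Smooth n M →ₐ[ℝ] Smooth e E where
  toFun h := ⟨h ∘ π, h.contMDiff.comp hπ⟩
  map_one' := rfl
  map_mul' _ _ := rfl
  map_zero' := rfl
  map_add' _ _ := rfl
  commutes' _ := rfl

/-- All fibres are copies of `Q`, so one point of `E` makes every fibre nonempty. -/
theorem IsSmoothFiberBundle.surjective [Nonempty E] (hπ : IsSmoothFiberBundle n e r Q π) :
    Function.Surjective π := by
  intro x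
  obtain ⟨z⟩ := ‹Nonempty E›
  obtain ⟨t', hz, -⟩ := hπ.2 (π z)
  obtain ⟨t, hx, -⟩ := hπ.2 x
  exact ⟨t.toOpenPartialHomeomorph.symm (x, (t' z).2), t.proj_symm_apply' hx⟩

/-- A fibre bundle has local sections. -/
theorem IsSmoothFiberBundle.exists_local_section [IsManifold (𝓡 n) ∞ M] [T2Space M]
    (hπ : IsSmoothFiberBundle n e r Q π) (z₀ : E) :
    ∃ σ : M → E, σ (π z₀) = z₀ ∧ (∀ᶠ x in 𝓝 (π z₀), π (σ x) = x) ∧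
      ∀ b : Smooth e E, ∃ c : Smooth n M, ∀ᶠ x in 𝓝 (π z₀), c x = b (σ x) := by
  obtain ⟨t, ht, -, hs⟩ := hπ.2 (π z₀)
  have hz : z₀ ∈ t.source := t.mem_source.2 ht
  have hmem : ∀ᶠ x in 𝓝 (π z₀), x ∈ t.baseSet := t.open_baseSet.mem_nhds ht
  -- The section through `z₀` with constant fibre component in a local trivialization.
  refine ⟨fun x => t.toOpenPartialHomeomorph.symm (x, (t z₀).2), ?_,
    hmem.mono fun x hx => t.proj_symm_apply' hx, fun b => ?_⟩
  · rw [← t.coe_fst' ht]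
    exact t.toOpenPartialHomeomorph.left_inv hz
  · refine exists_smooth_eventuallyEq (g := fun x => b (t.toOpenPartialHomeomorph.symm _))
      (hmem.mono fun x hx => b.contMDiff.contMDiffAt.comp x ?_)
    have hx' : (x, (t z₀).2) ∈ t.target := t.mem_target.2 hx
    exact ((hs _ hx').contMDiffAt (t.open_target.mem_nhds hx')).comp x
      (contMDiffAt_id.prodMk contMDiffAt_const)

/-- The retraction onto the fibre given by a local trivialization; it does not change vertical
tangent vectors to the fibre. -/
theorem IsSmoothFiberBundle.exists_fibre_retraction [IsManifold (𝓡 n) ∞ M] [T2Space M]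
    [IsManifold (𝓡 e) ∞ E] [T2Space E] [IsManifold (𝓡 r) ∞ Q]
    (hπ : IsSmoothFiberBundle n e r Q π) (z₀ : E) :
    ∃ ρ : E → E, ρ z₀ = z₀ ∧ (∀ᶠ z in 𝓝 z₀, π (ρ z) = π z₀) ∧
      ∀ b : Smooth e E, ∃ b' : Smooth e E, (∀ᶠ z in 𝓝 z₀, b' z = b (ρ z)) ∧
        ∀ δ, IsPointDer (smoothEv e E) z₀ δ → (∀ h, δ (pullbackHom hπ.1 h) = 0) → δ b' = δ b := by
  obtain ⟨t, ht, ht1, ht2⟩ := hπ.2 (π z₀)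
  have hz : z₀ ∈ t.source := t.mem_source.2 ht
  have hsrc : ∀ᶠ z in 𝓝 z₀, z ∈ t.source := t.open_source.mem_nhds hz
  have htAt : ∀ z ∈ t.source, ContMDiffAt (𝓡 e) ((𝓡 n).prod (𝓡 r)) ∞ t z := fun z hz =>
    (ht1 z hz).contMDiffAt (t.open_source.mem_nhds hz)
  have htsAt : ∀ w ∈ t.target, ContMDiffAt ((𝓡 n).prod (𝓡 r)) (𝓡 e) ∞
      t.toOpenPartialHomeomorph.symm w := fun w hw =>
    (ht2 w hw).contMDiffAt (t.open_target.mem_nhds hw)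
  let ρ : E → E := fun z => t.toOpenPartialHomeomorph.symm (π z₀, (t z).2)
  have hρt : ∀ z, (π z₀, (t z).2) ∈ t.target := fun z => t.mem_target.2 ht
  have htρ : ∀ z, t (ρ z) = (π z₀, (t z).2) := fun z => t.apply_symm_apply (hρt z)
  have hρ0 : ρ z₀ = z₀ := by
    simp only [ρ]
    rw [← t.coe_fst' ht]
    exact t.toOpenPartialHomeomorph.left_inv hz
  have hρs : ∀ z ∈ t.source, ContMDiffAt (𝓡 e) (𝓡 e) ∞ ρ z := fun z hz =>
    (htsAt _ (hρt z)).comp z (contMDiffAt_const.prodMk ((htAt z hz).snd))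
  -- adapted coordinates
  let φ := chartAt (EuclideanSpace ℝ (Fin n)) (π z₀)
  let ψ := chartAt (EuclideanSpace ℝ (Fin r)) (t z₀).2
  let εn := EuclideanSpace.equiv (Fin n) ℝ
  let εr := EuclideanSpace.equiv (Fin r) ℝ
  let Φ₁ : M → Fin n → ℝ := fun x => εn (φ x)
  let Φ₂ : E → Fin r → ℝ := fun z => εr (ψ (t z).2)
  let Φ : E → Fin n ⊕ Fin r → ℝ := fun z => Sum.elim (Φ₁ (π z)) (Φ₂ z)
  let p₁ : (Fin n ⊕ Fin r → ℝ) → EuclideanSpace ℝ (Fin n) := fun v =>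
    εn.symm fun i => v (Sum.inl i)
  let p₂ : (Fin n ⊕ Fin r → ℝ) → EuclideanSpace ℝ (Fin r) := fun v =>
    εr.symm fun i => v (Sum.inr i)
  have hp₁ : ContDiff ℝ ∞ p₁ := εn.symm.contDiff.comp (by fun_prop)
  have hp₂ : ContDiff ℝ ∞ p₂ := εr.symm.contDiff.comp (by fun_prop)
  let Ψ : (Fin n ⊕ Fin r → ℝ) → E := fun v =>
    t.toOpenPartialHomeomorph.symm (φ.symm (p₁ v), ψ.symm (p₂ v))
  have hp₁Φ : ∀ z, p₁ (Φ z) = φ (π z) := fun z => εn.symm_apply_apply _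
  have hp₂Φ : ∀ z, p₂ (Φ z) = ψ (t z).2 := fun z => εr.symm_apply_apply _
  have hφ : ∀ᶠ x in 𝓝 (π z₀), x ∈ φ.source := φ.open_source.mem_nhds (mem_chart_source _ _)
  have hψ : ∀ᶠ y in 𝓝 (t z₀).2, y ∈ ψ.source := ψ.open_source.mem_nhds (mem_chart_source _ _)
  have hπφ : ∀ᶠ z in 𝓝 z₀, π z ∈ φ.source := hπ.1.continuous.continuousAt.eventually hφ
  have htψ : ∀ᶠ z in 𝓝 z₀, (t z).2 ∈ ψ.source :=
    (htAt z₀ hz).continuousAt.snd.eventually hψ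
  have hΦ₁s : ∀ x ∈ φ.source, ContMDiffAt (𝓡 n) 𝓘(ℝ, Fin n → ℝ) ∞ Φ₁ x := fun x hx =>
    εn.contDiff.contMDiff.contMDiffAt.comp x
      ((contMDiffOn_chart (I := 𝓡 n) (x := π z₀) x hx).contMDiffAt (φ.open_source.mem_nhds hx))
  have hΦ₂s : ∀ z ∈ t.source, (t z).2 ∈ ψ.source →
      ContMDiffAt (𝓡 e) 𝓘(ℝ, Fin r → ℝ) ∞ Φ₂ z := fun z hz hy =>
    εr.contDiff.contMDiff.contMDiffAt.comp z
      (((contMDiffOn_chart (I := 𝓡 r) (x := (t z₀).2) _ hy).contMDiffAt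
        (ψ.open_source.mem_nhds hy)).comp z (htAt z hz).snd)
  choose h hh using fun i : Fin n => exists_smooth_eventuallyEq (n := n) (x := π z₀)
    (g := fun x => Φ₁ x i) (hφ.mono fun x hx => contMDiffAt_pi_space.1 (hΦ₁s x hx) i)
  choose k hk using fun j : Fin r => exists_smooth_eventuallyEq (n := e) (x := z₀)
    (g := fun z => Φ₂ z j) ((hsrc.and htψ).mono fun z hz' =>
      contMDiffAt_pi_space.1 (hΦ₂s z hz'.1 hz'.2) j)
  have hΦc : ContinuousAt Φ z₀ := by
    refine continuousAt_pi.2 (Sum.rec (fun i => ?_) fun j => ?_)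
    · exact (continuousAt_apply i _).comp (f := fun z => Φ₁ (π z))
        ((hΦ₁s _ hφ.self_of_nhds).continuousAt.comp hπ.1.continuous.continuousAt)
    · exact (continuousAt_apply j _).comp (hΦ₂s z₀ hz htψ.self_of_nhds).continuousAt
  have hΨ : ∀ᶠ v in 𝓝 (Φ z₀), ContMDiffAt 𝓘(ℝ, Fin n ⊕ Fin r → ℝ) (𝓡 e) ∞ Ψ v := by
    have h1 : ∀ᶠ v in 𝓝 (Φ z₀), p₁ v ∈ φ.target ∩ φ.symm ⁻¹' t.baseSet := by
      refine (φ.isOpen_inter_preimage_symm t.open_baseSet |>.preimage hp₁.continuous).mem_nhds ?_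
      rw [Set.mem_preimage, hp₁Φ]
      exact ⟨φ.map_source hφ.self_of_nhds, by
        rw [Set.mem_preimage, φ.left_inv hφ.self_of_nhds]; exact ht⟩
    have h2 : ∀ᶠ v in 𝓝 (Φ z₀), p₂ v ∈ ψ.target := by
      refine (ψ.open_target.preimage hp₂.continuous).mem_nhds ?_
      rw [Set.mem_preimage, hp₂Φ]
      exact ψ.map_source hψ.self_of_nhds
    filter_upwards [h1, h2] with v h1 h2
    refine (htsAt (φ.symm (p₁ v), ψ.symm (p₂ v)) (t.mem_target.2 h1.2)).comp v (ContMDiffAt.prodMk ?_ ?_)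
    · exact ((contMDiffOn_chart_symm (I := 𝓡 n) (x := π z₀) _ h1.1).contMDiffAt
        (φ.open_target.mem_nhds h1.1)).comp v hp₁.contMDiff.contMDiffAt
    · exact ((contMDiffOn_chart_symm (I := 𝓡 r) (x := (t z₀).2) _ h2).contMDiffAt
        (ψ.open_target.mem_nhds h2)).comp v hp₂.contMDiff.contMDiffAt
  have hΨΦ : ∀ᶠ z in 𝓝 z₀, Ψ (Φ z) = z := by
    filter_upwards [hsrc, hπφ, htψ] with z h1 h2 h3
    simp only [Ψ]
    rw [hp₁Φ, hp₂Φ, φ.left_inv h2, ψ.left_inv h3, ← t.coe_fst h1]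
    exact t.toOpenPartialHomeomorph.left_inv h1
  refine ⟨ρ, hρ0, Filter.Eventually.of_forall fun z => t.proj_symm_apply' ht, fun b => ?_⟩
  obtain ⟨b', hb'⟩ := exists_smooth_eventuallyEq (n := e) (x := z₀) (g := fun z => b (ρ z))
    (hsrc.mono fun z hz => b.contMDiff.contMDiffAt.comp z (hρs z hz))
  refine ⟨b', hb', fun δ hδ hδ0 => ?_⟩
  obtain ⟨G, hG, -, hbG⟩ := exists_eq_comp_coordinates hΦc hΨ hΨΦ b
  have hD := isDifferentialSpace_smoothEv e E
  have hh' : ∀ᶠ z in 𝓝 z₀, ∀ i, h i (π z) = Φ₁ (π z) i :=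
    hπ.1.continuous.continuousAt.eventually (Filter.eventually_all.2 hh)
  have hk' : ∀ᶠ z in 𝓝 z₀, ∀ j, k j z = Φ₂ z j := Filter.eventually_all.2 hk
  -- Near `z₀`, `b` is `G` of the coordinates `g`, and `b'` is `G` of `g'`, where the base
  -- coordinates are frozen at their values at `z₀`. Since `δ` kills base coordinates as well as
  -- constants, the chain rule gives the same value for both.
  let g : Fin n ⊕ Fin r → Smooth e E := Sum.elim (fun i => pullbackHom hπ.1 (h i)) k
  let g' : Fin n ⊕ Fin r → Smooth e E :=
    Sum.elim (fun i => algebraMap ℝ _ (Φ₁ (π z₀) i)) k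
  have hg0 : (fun i => smoothEv e E (g' i) z₀) = fun i => smoothEv e E (g i) z₀ := by
    funext i
    rcases i with i | j
    · exact (hh'.self_of_nhds i).symm
    · rfl
  rw [hδ.comp hD (f := b) (g := g) hG, hδ.comp hD (f := b') (g := g') hG, hg0]
  · refine Finset.sum_congr rfl fun i _ => ?_
    rcases i with i | j
    · simp [g, g', hδ0, hδ.map_algebraMap]
    · rfl
  · rw [nearFilter_smoothEv]
    have hρc : Filter.Tendsto ρ (𝓝 z₀) (𝓝 z₀) := by
      simpa only [hρ0] using (hρs z₀ hz).continuousAt.tendsto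
    filter_upwards [hb', hρc.eventually hbG, hk'] with z h1 h2 h3
    rw [smoothEv_apply, h1, h2]
    congr 1
    funext i
    rcases i with i | j
    · simp only [Φ, Sum.elim_inl, g', smoothEv]
      rw [show π (ρ z) = π z₀ from t.proj_symm_apply' ht]
      rfl
    · simp only [Φ, Sum.elim_inr, g', smoothEv_apply, Φ₂, h3, htρ]
  · rw [nearFilter_smoothEv]
    filter_upwards [hbG, hh', hk'] with z h1 h2 h3
    rw [smoothEv_apply, h1]
    congr 1
    funext i
    rcases i with i | j
    · exact (h2 i).symm
    · exact (h3 j).symm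

end Bundles

/-! ### Pushing point derivations forward -/

section Pushforward

variable {X N B : Type*} {𝒢 : Set (X → ℝ)} [CommRing B] [Algebra ℝ B] {evN : B →ₐ[ℝ] (N → ℝ)}
  {s : N → X} {z₀ : N}

/-- A map under which the generators pull back to germs of smooth functions pulls all smooth
functions back to germs of smooth functions. -/
theorem exists_pullback_germ (hN : IsDifferentialSpace evN)
    (h : ∀ g ∈ 𝒢, ∃ k : B, ∀ᶠ z in nearFilter evN z₀, evN k z = g (s z))
    (f : generatedSmooth 𝒢) : ∃ k : B, ∀ᶠ z in nearFilter evN z₀, evN k z = f.1 (s z) := by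
  obtain ⟨n, g, G, O, hg, hG, hO, hx, hf⟩ := f.2 (s z₀)
  choose k hk using fun i => h (g i) (hg i)
  have hk' := Filter.eventually_all.2 hk
  obtain ⟨a, ha⟩ := hN.exists_comp k hG
  refine ⟨a, ?_⟩
  filter_upwards [hk', hN.eventually_mem k hO (by simpa only [self_of_nearFilter hk'] using hx)]
    with z h1 h2
  simp only [h1] at h2
  rw [ha, hf _ h2]
  simp only [h1]

/-- The image of a point derivation under such a map. -/
theorem exists_pushforward (hN : IsDifferentialSpace evN)
    (h : ∀ g ∈ 𝒢, ∃ k : B, ∀ᶠ z in nearFilter evN z₀, evN k z = g (s z))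
    {δ : B → ℝ} (hδ : IsPointDer evN z₀ δ) :
    ∃ δ' : generatedSmooth 𝒢 → ℝ, IsPointDer (generatedSmooth 𝒢).val (s z₀) δ' ∧
      ∀ f k, (∀ᶠ z in nearFilter evN z₀, evN k z = f.1 (s z)) → δ' f = δ k := by
  choose k hk using fun f => exists_pullback_germ hN h f
  -- By locality `δ (k f)` does not depend on the chosen representative of the germ, so sums and
  -- products of representatives may be used.
  have hk' : ∀ (f : generatedSmooth 𝒢) (a : B),
      (∀ᶠ z in nearFilter evN z₀, evN a z = f.1 (s z)) → δ (k f) = δ a := fun f a ha =>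
    hδ.congr hN (((hk f).and ha).mono fun z hz => hz.1.trans hz.2.symm)
  refine ⟨fun f => δ (k f), ⟨fun f g => ?_, fun c f => ?_, fun f g => ?_⟩, hk'⟩
  · rw [hk' (f + g) (k f + k g), hδ.map_add]
    filter_upwards [hk f, hk g] with z h1 h2
    simp [h1, h2]
  · rw [hk' (c • f) (c • k f), hδ.map_smul]
    filter_upwards [hk f] with z h1
    simp [h1]
  · rw [hk' (f * g) (k f * k g), hδ.leibniz, self_of_nearFilter (hk f),
      self_of_nearFilter (hk g)]
    · rfl
    · filter_upwards [hk f, hk g] with z h1 h2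
      simp [h1, h2]

end Pushforward

/-! ### Tangent vectors and vector fields on `𝓔` and `𝓔'` -/

section Equations

variable {n d : ℕ} {M Y : Type*}
  [TopologicalSpace M] [ChartedSpace (EuclideanSpace ℝ (Fin n)) M]
  [TopologicalSpace Y] [ChartedSpace (EuclideanSpace ℝ (Fin d)) Y]
  {ζ : Y → M} {k : ℕ} (E₀ : Set (Jet n d ζ (k : ℕ∞)))

/-- The values of the smooth functions on an equation. -/
noncomputable def eqnEv : EqnFun E₀ →ₐ[ℝ] (Eqn E₀ → ℝ) := (eqnSmooth E₀).val

theorem isDifferentialSpace_eqnEv : IsDifferentialSpace (eqnEv E₀) :=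
  isDifferentialSpace_generatedSmooth

theorem generates_eqnEv : Generates (eqnEv E₀) (Set.range (restrictEqn E₀)) := by
  intro f x
  obtain ⟨N, g, G, hg, h⟩ := generates_generatedSmooth f x
  refine ⟨N, g, G, fun i => ?_, h⟩
  obtain ⟨u, hu, h⟩ := hg i
  exact ⟨⟨u, hu⟩, Subtype.ext h.symm⟩

variable {E₀}

/-- On the generators both sides differentiate one function on `M`, the pullback along a common
representative of the jet, and this involves `X` and `X'` only at the base point. -/
theorem IsCartanLiftAt.apply_eq {X X' : VF n M} {θ : Eqn E₀} {v v' : EqnFun E₀ → ℝ}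
    (hX : IsCartanLiftAt E₀ X θ v) (hX' : IsCartanLiftAt E₀ X' θ v')
    (h : ∀ f, X f θ.1.base = X' f θ.1.base) (hv : IsPointDer (eqnEv E₀) θ v)
    (hv' : IsPointDer (eqnEv E₀) θ v') (f : EqnFun E₀) : v f = v' f := by
  refine hv.ext_of_generates hv' (isDifferentialSpace_eqnEv E₀) (generates_eqnEv E₀) ?_ f
  rintro _ ⟨u, rfl⟩
  obtain ⟨a, ha⟩ := Quotient.exists_rep θ.1
  rw [hX a ha u, hX' a ha u]
  have hb : θ.1.base = a.pt := by rw [← ha]; rfl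
  rw [hb] at h
  exact h _

variable {e r : ℕ} {E Q : Type*} [TopologicalSpace E] [ChartedSpace (EuclideanSpace ℝ (Fin e)) E]
  [TopologicalSpace Q] [ChartedSpace (EuclideanSpace ℝ (Fin r)) Q]
  {π : E → M}

variable (E₀ e π) in
/-- The values of the smooth functions on the pullback of a bundle to an equation. -/
noncomputable def pullbackEv : PullbackFun E₀ e π →ₐ[ℝ] (Pullback E₀ π → ℝ) := (pullbackSmooth E₀ e π).val

variable (E₀ e π) in
theorem isDifferentialSpace_pullbackEv : IsDifferentialSpace (pullbackEv E₀ e π) :=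
  isDifferentialSpace_generatedSmooth

variable (E₀ e π) in
theorem generates_pullbackEv : Generates (pullbackEv E₀ e π)
    (Set.range (tauStar E₀ e π) ∪ Set.range (xiStar' E₀ e π)) := by
  intro f x
  obtain ⟨N, g, G, hg, h⟩ := generates_generatedSmooth f x
  refine ⟨N, g, G, fun i => ?_, h⟩
  obtain ⟨u, hu, h⟩ | ⟨b, h⟩ := hg i
  · exact Or.inl ⟨⟨u, hu⟩, Subtype.ext h.symm⟩
  · exact Or.inr ⟨b, Subtype.ext h.symm⟩

/-- This is `ξ ∘ τ = π ∘ ξ'`, the defining condition of the fibre product. -/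
theorem etaStar_eq (hπ : ContMDiff (𝓡 e) (𝓡 n) ∞ π) (h : Smooth n M) :
    etaStar E₀ e π h = xiStar' E₀ e π (pullbackHom hπ h) :=
  Subtype.ext <| funext fun q => congrArg h q.2

theorem derivation_ext {Z W : Derivation ℝ (PullbackFun E₀ e π) (PullbackFun E₀ e π)}
    (h : ∀ f, Z (tauStar E₀ e π f) = W (tauStar E₀ e π f))
    (h' : ∀ g, Z (xiStar' E₀ e π g) = W (xiStar' E₀ e π g)) : Z = W := by
  refine derivation_ext_of_generates (isDifferentialSpace_pullbackEv E₀ e π)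
    (generates_pullbackEv E₀ e π) ?_
  rintro _ (⟨f, rfl⟩ | ⟨g, rfl⟩)
  exacts [h f, h' g]

/-- Supplies the hypothesis of `exists_pullback_germ` and `exists_pushforward` for a local section
of `τ` along which functions on `E` become functions on `M`. -/
theorem pullback_generators_germ {s : Eqn E₀ → Pullback E₀ π} {q : Pullback E₀ π}
    (hs : ∀ᶠ θ in nearFilter (eqnEv E₀) q.1.1, (s θ).1.1 = θ)
    (hb : ∀ b : Smooth e E, ∃ c : Smooth n M,
      ∀ᶠ θ in nearFilter (eqnEv E₀) q.1.1, c θ.1.base = b (s θ).1.2) :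
    ∀ g ∈ ({f | ∃ u ∈ eqnSmooth E₀, f = fun q => u q.1.1} ∪
      {f | ∃ g : Smooth e E, f = fun q => g q.1.2} : Set (Pullback E₀ π → ℝ)),
      ∃ a : EqnFun E₀, ∀ᶠ θ in nearFilter (eqnEv E₀) q.1.1, eqnEv E₀ a θ = g (s θ) := by
  rintro _ (⟨u, hu, rfl⟩ | ⟨b, rfl⟩)
  · refine ⟨⟨u, hu⟩, hs.mono fun θ h => ?_⟩
    simp only [h]
    rfl
  · obtain ⟨c, hc⟩ := hb b
    exact ⟨xiStar E₀ c, hc⟩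

variable [IsManifold (𝓡 n) ∞ M] [T2Space M]

/-- The pullback of `ξ^* h` along `j_∞(s)` is `h` wherever `s` is a section, hence near the base
point; the default value of `jetPull` plays no role. -/
theorem IsCartanLiftAt.apply_xiStar {X : VF n M} {θ : Eqn E₀} {v : EqnFun E₀ → ℝ}
    (hX : IsCartanLiftAt E₀ X θ v) (h : Smooth n M) : v (xiStar E₀ h) = X h θ.1.base := by
  obtain ⟨a, ha⟩ := Quotient.exists_rep θ.1
  refine (hX a ha _).trans ?_
  have hb : θ.1.base = a.pt := by rw [← ha]; rfl
  rw [hb]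
  refine derivAt_singleton X ?_
  filter_upwards [eventually_eventually_nhds.2 a.isSection] with x hx
  rw [jetPull, dif_pos (show IsSectionNear n d ζ a.sec x from hx)]
  rfl

/-- Through every point of `𝓔'` there is a local section of `τ` pulled back from a local section
of `π`. -/
theorem exists_section_pullback (hπ : IsSmoothFiberBundle n e r Q π) (q : Pullback E₀ π) :
    ∃ s : Eqn E₀ → Pullback E₀ π, s q.1.1 = q ∧
      (∀ᶠ θ in nearFilter (eqnEv E₀) q.1.1, (s θ).1.1 = θ) ∧
      ∀ b : Smooth e E, ∃ c : Smooth n M,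
        ∀ᶠ θ in nearFilter (eqnEv E₀) q.1.1, c θ.1.base = b (s θ).1.2 := by
  classical
  obtain ⟨σ, h0, h1, h2⟩ := hπ.exists_local_section q.1.2
  rw [← q.2] at h0 h1 h2
  have hT : Filter.Tendsto (fun θ : Eqn E₀ => θ.1.base) (nearFilter (eqnEv E₀) q.1.1)
      (𝓝 q.1.1.1.base) := by
    have := tendsto_nearFilter (ev := eqnEv E₀) (ev' := smoothEv n M) (φ := xiStar E₀)
      (p := fun θ : Eqn E₀ => θ.1.base) (fun f x => rfl) q.1.1
    rwa [nearFilter_smoothEv] at this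
  -- The default `q` only makes `s` total: the condition holds near the point considered.
  let s : Eqn E₀ → Pullback E₀ π := fun θ =>
    if h : π (σ θ.1.base) = θ.1.base then ⟨(θ, σ θ.1.base), h.symm⟩ else q
  have hs : ∀ θ, π (σ θ.1.base) = θ.1.base → (s θ).1 = (θ, σ θ.1.base) := fun θ h => by
    simp only [s, dif_pos h]
  refine ⟨s, Subtype.ext ?_, ?_, fun b => ?_⟩
  · rw [hs _ (by rw [h0]; exact q.2.symm), h0]
  · filter_upwards [hT.eventually h1] with θ h
    rw [hs θ h]
  · obtain ⟨c, hc⟩ := h2 b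
    refine ⟨c, ?_⟩
    filter_upwards [hT.eventually h1, hT.eventually hc] with θ h h'
    rw [hs θ h, h']

/-- The functions on `𝓔'` that are constant along the fibres of `τ` are pulled back from `𝓔`. -/
theorem exists_tauStar_eq (hπ : IsSmoothFiberBundle n e r Q π) (q₀ : Pullback E₀ π)
    {g : PullbackFun E₀ e π}
    (hg : ∀ q q' : Pullback E₀ π, q.1.1 = q'.1.1 → pullbackEv E₀ e π g q = pullbackEv E₀ e π g q') :
    ∃ f, tauStar E₀ e π f = g := by
  have : Nonempty E := ⟨q₀.1.2⟩
  choose σ hσ using hπ.surjective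
  -- A set-theoretic section of `τ`, with no regularity. As `g` is constant along the fibres, `t`
  -- may be replaced near each point by a smooth local section.
  let t : Eqn E₀ → Pullback E₀ π := fun θ => ⟨(θ, σ θ.1.base), (hσ _).symm⟩
  obtain ⟨f, hf⟩ := (isDifferentialSpace_eqnEv E₀).exists_of_local
    (fun θ => pullbackEv E₀ e π g (t θ)) fun θ => by
      obtain ⟨s, -, hs, hb⟩ := exists_section_pullback (E₀ := E₀) hπ (t θ)
      obtain ⟨a, ha⟩ := exists_pullback_germ (isDifferentialSpace_eqnEv E₀)
        (pullback_generators_germ hs hb) g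
      refine ⟨a, ?_⟩
      filter_upwards [ha, hs] with θ' h1 h2
      rw [h1]
      exact hg _ _ h2.symm
  exact ⟨f, (isDifferentialSpace_pullbackEv E₀ e π).injective <| funext fun q =>
    (congrFun hf q.1.1).trans (hg _ _ rfl)⟩

/-- The lift `Ŝ` of a vertical vector field on the equation. -/
theorem exists_isHat (hπ : IsSmoothFiberBundle n e r Q π)
    {S : Derivation ℝ (EqnFun E₀) (EqnFun E₀)} (hS : ∀ h, S (xiStar E₀ h) = 0) :
    ∃ Z : Derivation ℝ (PullbackFun E₀ e π) (PullbackFun E₀ e π),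
      (∀ f, Z (tauStar E₀ e π f) = tauStar E₀ e π (S f)) ∧ ∀ b, Z (xiStar' E₀ e π b) = 0 := by
  -- The value of `S` is pushed forward along a local section of `τ` induced by one of `π`.
  -- Functions on `E` become functions on `M`, which `S` kills.
  have key : ∀ q : Pullback E₀ π, ∃ δ, IsPointDer (pullbackEv E₀ e π) q δ ∧
      (∀ f, δ (tauStar E₀ e π f) = eqnEv E₀ (S f) q.1.1) ∧ ∀ b, δ (xiStar' E₀ e π b) = 0 := by
    intro q
    obtain ⟨s, h0, hs, hb⟩ := exists_section_pullback (E₀ := E₀) hπ q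
    obtain ⟨δ, hδ, h⟩ := exists_pushforward (isDifferentialSpace_eqnEv E₀)
        (pullback_generators_germ hs hb) (IsPointDer.of_derivation (ev := eqnEv E₀) S q.1.1)
    rw [h0] at hδ
    refine ⟨δ, hδ, fun f => h _ _ (hs.mono fun θ hθ => ?_), fun b => ?_⟩
    · exact congrArg (eqnEv E₀ f) hθ.symm
    · obtain ⟨c, hc⟩ := hb b
      rw [h (xiStar' E₀ e π b) (xiStar E₀ c) hc, hS]
      simp
  choose δ hδ h1 h2 using key
  obtain ⟨Z, hZ⟩ := (isDifferentialSpace_pullbackEv E₀ e π).exists_derivation_of_generates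
    (generates_pullbackEv E₀ e π) hδ (by
      rintro _ (⟨f, rfl⟩ | ⟨b, rfl⟩)
      · exact ⟨tauStar E₀ e π (S f), fun q => h1 q f⟩
      · exact ⟨0, fun q => by simp [h2]⟩)
  refine ⟨Z, fun f => (isDifferentialSpace_pullbackEv E₀ e π).injective <| funext fun q => ?_,
    fun b => (isDifferentialSpace_pullbackEv E₀ e π).injective <| funext fun q => ?_⟩
  · rw [hZ, h1]; rfl
  · rw [hZ, h2, map_zero]; rfl

/-- A `τ`-vertical vector field kills the functions that are constant along the fibres of `τ`. -/
theorem apply_eq_zero_of_tau_vertical (hπ : IsSmoothFiberBundle n e r Q π)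
    {V : Derivation ℝ (PullbackFun E₀ e π) (PullbackFun E₀ e π)}
    (hV : ∀ f, V (tauStar E₀ e π f) = 0) {g : PullbackFun E₀ e π}
    (hg : ∀ q q' : Pullback E₀ π, q.1.1 = q'.1.1 → pullbackEv E₀ e π g q = pullbackEv E₀ e π g q') :
    V g = 0 := by
  refine (isDifferentialSpace_pullbackEv E₀ e π).injective <| funext fun q => ?_
  obtain ⟨f, rfl⟩ := exists_tauStar_eq hπ q hg
  rw [hV]

/-- The tangent vectors to the fibres of `π` lift to tangent vectors to the fibres of `τ`. -/
theorem exists_fibre_pointDer [IsManifold (𝓡 e) ∞ E] [T2Space E] [IsManifold (𝓡 r) ∞ Q]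
    (hπ : IsSmoothFiberBundle n e r Q π) (q : Pullback E₀ π) {δ : Smooth e E → ℝ}
    (hδ : IsPointDer (smoothEv e E) q.1.2 δ) (hδ0 : ∀ h, δ (pullbackHom hπ.1 h) = 0) :
    ∃ δ', IsPointDer (pullbackEv E₀ e π) q δ' ∧ (∀ b, δ' (xiStar' E₀ e π b) = δ b) ∧
      ∀ f, (∀ q', q'.1.1 = q.1.1 → pullbackEv E₀ e π f q' = pullbackEv E₀ e π f q) → δ' f = 0 := by
  classical
  obtain ⟨ρ, h0, h1, h2⟩ := hπ.exists_fibre_retraction q.1.2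
  rw [← nearFilter_smoothEv (n := e)] at h1 h2
  -- `s` sends points near `q.1.2`, retracted to the fibre of `π`, into the fibre of `τ` over
  -- `q.1.1`. Because `δ` is vertical, the retraction does not change its action on functions on
  -- `E`.
  let s : E → Pullback E₀ π := fun z =>
    if h : π (ρ z) = π q.1.2 then ⟨(q.1.1, ρ z), q.2.trans h.symm⟩ else q
  have hs : ∀ z, π (ρ z) = π q.1.2 → (s z).1 = (q.1.1, ρ z) := fun z h => by
    simp only [s, dif_pos h]
  have hs0 : s q.1.2 = q := Subtype.ext (by rw [hs _ (by rw [h0]), h0])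
  have hs1 : ∀ z, (s z).1.1 = q.1.1 := fun z => by
    simp only [s]
    split_ifs <;> rfl
  have hs2 : ∀ᶠ z in nearFilter (smoothEv e E) q.1.2, (s z).1.2 = ρ z :=
    h1.mono fun z h => by rw [hs z h]
  obtain ⟨δ', hδ', h⟩ := exists_pushforward (s := s) (isDifferentialSpace_smoothEv e E)
    (𝒢 := {f | ∃ u ∈ eqnSmooth E₀, f = fun q => u q.1.1} ∪
      {f | ∃ g : Smooth e E, f = fun q => g q.1.2}) (by
      rintro _ (⟨u, hu, rfl⟩ | ⟨b, rfl⟩)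
      · exact ⟨algebraMap ℝ _ (u q.1.1), Filter.Eventually.of_forall fun z => by
          simp only [hs1]; rfl⟩
      · obtain ⟨b', hb', -⟩ := h2 b
        exact ⟨b', (hb'.and hs2).mono fun z hz => by simp only [hz.2, smoothEv_apply, hz.1]⟩) hδ
  rw [hs0] at hδ'
  refine ⟨δ', hδ', fun b => ?_, fun f hf => ?_⟩
  · obtain ⟨b', hb', hbδ⟩ := h2 b
    rw [h (xiStar' E₀ e π b) b', hbδ δ hδ hδ0]
    exact (hb'.and hs2).mono fun z hz =>
      hz.1.trans (congrArg b hz.2.symm)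
  · rw [h f (algebraMap ℝ _ (pullbackEv E₀ e π f q)), hδ.map_algebraMap]
    exact Filter.Eventually.of_forall fun z => (hf (s z) (hs1 z)).symm

variable [IsManifold (𝓡 e) ∞ E] [T2Space E] [IsManifold (𝓡 r) ∞ Q]

/-- A `π`-vertical vector field along `ξ'` extends to a `τ`-vertical vector field. -/
theorem exists_vertical_extension (hπ : IsSmoothFiberBundle n e r Q π)
    {D : DerAlong (xiStar' E₀ e π)} (hD : ∀ h, D.1 (pullbackHom hπ.1 h) = 0) :
    ∃ Z : Derivation ℝ (PullbackFun E₀ e π) (PullbackFun E₀ e π),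
      (∀ f, Z (tauStar E₀ e π f) = 0) ∧ ∀ b, Z (xiStar' E₀ e π b) = D.1 b := by
  choose δ hδ h1 h2 using fun q : Pullback E₀ π => exists_fibre_pointDer hπ q
    (IsPointDer.of_derAlong (ev := pullbackEv E₀ e π) (ev' := smoothEv e E) (x := q)
      (x' := q.1.2) D (fun f => rfl)) (fun h => by rw [hD]; simp)
  have h3 : ∀ q f, δ q (tauStar E₀ e π f) = 0 := fun q f =>
    h2 q _ fun q' hq => congrArg (eqnEv E₀ f) hq
  obtain ⟨Z, hZ⟩ := (isDifferentialSpace_pullbackEv E₀ e π).exists_derivation_of_generates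
    (generates_pullbackEv E₀ e π) hδ (by
      rintro _ (⟨f, rfl⟩ | ⟨b, rfl⟩)
      · exact ⟨0, fun q => by simp [h3]⟩
      · exact ⟨D.1 b, fun q => h1 q b⟩)
  refine ⟨Z, fun f => (isDifferentialSpace_pullbackEv E₀ e π).injective <| funext fun q => ?_,
    fun b => (isDifferentialSpace_pullbackEv E₀ e π).injective <| funext fun q => ?_⟩
  · rw [hZ, h3, map_zero]; rfl
  · rw [hZ, h1]

end Equations

/-! ### Algebra of connections and of the Frölicher–Nijenhuis bracket -/

section Algebra

variable {A B : Type*} [CommRing A] [Algebra ℝ A] [CommRing B] [Algebra ℝ B] {φ : B →ₐ[ℝ] A}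

theorem smul_lie_derivation (a : A) (Z W : Derivation ℝ A A) :
    ⁅a • Z, W⁆ = a • ⁅Z, W⁆ - W a • Z := by
  ext f
  simp only [Derivation.commutator_apply, Derivation.sub_apply, Derivation.smul_apply,
    smul_eq_mul, Derivation.leibniz]
  ring

theorem lie_smul_derivation (a : A) (Z W : Derivation ℝ A A) :
    ⁅Z, a • W⁆ = a • ⁅Z, W⁆ + Z a • W := by
  ext f
  simp only [Derivation.commutator_apply, Derivation.add_apply, Derivation.smul_apply,
    smul_eq_mul, Derivation.leibniz]
  ring

theorem mem_vertical {Z : Derivation ℝ A A} : Z ∈ vertical φ ↔ ∀ b, Z (φ b) = 0 := by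
  refine LinearMap.mem_ker.trans ⟨fun h b => ?_, fun h => Subtype.ext (LinearMap.ext h)⟩
  exact LinearMap.congr_fun (congrArg Subtype.val h) b

theorem restr_apply (Z : Derivation ℝ A A) (b : B) : (restr φ Z).1 b = Z (φ b) := rfl

theorem lie_mem_vertical {Z W : Derivation ℝ A A} (hZ : Z ∈ vertical φ) (hW : W ∈ vertical φ) :
    ⁅Z, W⁆ ∈ vertical φ := by
  rw [mem_vertical] at *
  intro b
  rw [Derivation.commutator_apply, hZ, hW, map_zero, map_zero, sub_zero]

theorem lie_mem_of_mem_span {s : Set (Derivation ℝ A A)} {L : Submodule A (Derivation ℝ A A)}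
    (hs : s ⊆ L) {S : Derivation ℝ A A} (h : ∀ w ∈ s, ⁅S, w⁆ ∈ L) {W : Derivation ℝ A A}
    (hW : W ∈ Submodule.span A s) : ⁅S, W⁆ ∈ L := by
  induction hW using Submodule.span_induction with
  | mem w hw => exact h w hw
  | zero => rw [lie_zero]; exact L.zero_mem
  | add w w' _ _ h1 h2 => rw [lie_add]; exact L.add_mem h1 h2
  | smul a w hw h1 =>
    rw [lie_smul_derivation]
    exact L.add_mem (L.smul_mem _ h1) (L.smul_mem _ (Submodule.span_le.2 hs hw))

/-- By the Leibniz rule the coefficients contribute only multiples of generators; antisymmetry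
reduces the first argument to the second. -/
theorem lie_mem_span {s : Set (Derivation ℝ A A)}
    (h : ∀ z ∈ s, ∀ w ∈ s, ⁅z, w⁆ ∈ Submodule.span A s) {Z W : Derivation ℝ A A}
    (hZ : Z ∈ Submodule.span A s) (hW : W ∈ Submodule.span A s) :
    ⁅Z, W⁆ ∈ Submodule.span A s := by
  refine lie_mem_of_mem_span Submodule.subset_span (fun w hw => ?_) hW
  rw [← lie_skew]
  exact Submodule.neg_mem _ (lie_mem_of_mem_span Submodule.subset_span (h w hw) hZ)

namespace Connection

variable (F : Connection φ)

theorem restr_formU (Z : Derivation ℝ A A) : restr φ (F.formU Z) = restr φ Z :=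
  F.restr_toLin _

theorem formU_apply_base (Z : Derivation ℝ A A) (b : B) : F.formU Z (φ b) = Z (φ b) := by
  simpa only [restr_apply] using
    LinearMap.congr_fun (congrArg Subtype.val (F.restr_formU Z)) b

theorem lift_apply (X : Derivation ℝ B B) (b : B) : F.lift X (φ b) = φ (X b) :=
  LinearMap.congr_fun (congrArg Subtype.val (F.restr_toLin (pullDer φ X))) b

theorem formU_mem (Z : Derivation ℝ A A) : F.formU Z ∈ F.distribution := ⟨_, rfl⟩

theorem lift_mem (X : Derivation ℝ B B) : F.lift X ∈ F.distribution := ⟨_, rfl⟩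

theorem formU_eq_zero {Z : Derivation ℝ A A} (hZ : Z ∈ vertical φ) : F.formU Z = 0 := by
  rw [formU, LinearMap.comp_apply, show restr φ Z = 0 from hZ, map_zero]

theorem formU_eq_self {Z : Derivation ℝ A A} (hZ : Z ∈ F.distribution) : F.formU Z = Z := by
  obtain ⟨X, rfl⟩ := hZ
  rw [formU, LinearMap.comp_apply, F.restr_toLin]

theorem sub_formU_mem (Z : Derivation ℝ A A) : Z - F.formU Z ∈ vertical φ :=
  mem_vertical.2 fun b => by rw [Derivation.sub_apply, F.formU_apply_base, sub_self]

/-- On a function `b` of the base `Ū_F Z` acts as `Z` and `S` as zero, so both terms of the bracket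
give `-S (Z b)`. -/
theorem symCocycle_mem_vertical {S : Derivation ℝ A A} (hS : S ∈ vertical φ)
    (Z : Derivation ℝ A A) : symCocycle F S Z ∈ vertical φ := by
  rw [mem_vertical] at *
  intro b
  change (⁅F.formU Z, S⁆ - F.formU ⁅Z, S⁆) (φ b) = 0
  simp [Derivation.commutator_apply, hS, formU_apply_base]

theorem symCocycle_eq_zero {S : Derivation ℝ A A} (hS : S ∈ vertical φ)
    {Z : Derivation ℝ A A} (hZ : Z ∈ vertical φ) : symCocycle F S Z = 0 := by
  change ⁅F.formU Z, S⁆ - F.formU ⁅Z, S⁆ = 0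
  rw [F.formU_eq_zero hZ, F.formU_eq_zero (lie_mem_vertical hZ hS), zero_lie, sub_zero]

/-- A vertical field is a symmetry iff it commutes with `Ū_F`. -/
theorem isSymmetry_iff {S : Derivation ℝ A A} :
    IsSymmetry φ F.distribution S ↔ S ∈ vertical φ ∧ symCocycle F S = 0 := by
  refine and_congr_right fun hS => ⟨fun h => LinearMap.ext fun Z => ?_, fun h Y hY => ?_⟩
  · change ⁅F.formU Z, S⁆ - F.formU ⁅Z, S⁆ = 0
    have h1 : ⁅F.formU Z, S⁆ ∈ F.distribution := by
      rw [← lie_skew]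
      exact Submodule.neg_mem _ (h _ (F.formU_mem Z))
    -- A horizontal field is fixed by `Ū_F`, so the difference is `Ū_F` of the bracket of `Ū_F Z -
    -- Z` with `S`, both of which are vertical.
    rw [← F.formU_eq_self h1, ← map_sub, ← sub_lie]
    refine F.formU_eq_zero (lie_mem_vertical ?_ hS)
    rw [← neg_sub]
    exact Submodule.neg_mem _ (F.sub_formU_mem Z)
  · have h1 : ⁅F.formU Y, S⁆ - F.formU ⁅Y, S⁆ = 0 := LinearMap.congr_fun h Y
    rw [F.formU_eq_self hY] at h1
    rw [← lie_skew, sub_eq_zero.1 h1]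
    exact Submodule.neg_mem _ (F.formU_mem _)

end Connection

theorem fnBracket_sub (K : Derivation ℝ A A →ₗ[A] Derivation ℝ A A) (S V : Derivation ℝ A A) :
    fnBracket K (S - V) = fnBracket K S - fnBracket K V := by
  ext1 Z
  change ⁅K Z, S - V⁆ - K ⁅Z, S - V⁆ = (⁅K Z, S⁆ - K ⁅Z, S⁆) - (⁅K Z, V⁆ - K ⁅Z, V⁆)
  rw [lie_sub, lie_sub, map_sub]
  abel

/-- The graded Jacobi identity `⟦K, ⟦K, S⟧⟧ = 1/2 ⟦⟦K, K⟧, S⟧`, where the right-hand side vanishes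
when the Nijenhuis torsion of `K` does. -/
theorem fnBracket₂_fnBracket (K : Derivation ℝ A A →ₗ[A] Derivation ℝ A A)
    (hK : ∀ X Y, ⁅K X, K Y⁆ - K ⁅K X, Y⁆ - K ⁅X, K Y⁆ + K (K ⁅X, Y⁆) = 0)
    (S X Y : Derivation ℝ A A) : fnBracket₂ K (fnBracket K S) X Y = 0 := by
  -- The Lie derivative of the torsion along `S`: the torsion on `(X, Y)` bracketed with `S`, minus
  -- the torsions on `([X, S], Y)` and `(X, [Y, S])`. After the Jacobi identity and antisymmetry
  -- this is the left-hand side of the goal.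
  have h1 : ⁅⁅K X, K Y⁆ - K ⁅K X, Y⁆ - K ⁅X, K Y⁆ + K (K ⁅X, Y⁆), S⁆ = 0 := by
    rw [hK, zero_lie]
  have h2 := hK ⁅X, S⁆ Y
  have h3 := hK X ⁅Y, S⁆
  have hc : ∀ Z, fnBracket K S Z = ⁅K Z, S⁆ - K ⁅Z, S⁆ := fun _ => rfl
  have j1 : ⁅⁅X, S⁆, Y⁆ = ⁅⁅X, Y⁆, S⁆ - ⁅X, ⁅Y, S⁆⁆ := by
    rw [lie_lie X Y S, ← lie_skew Y ⁅X, S⁆]; abel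
  have j2 : ⁅⁅K X, S⁆, Y⁆ = ⁅⁅K X, Y⁆, S⁆ - ⁅K X, ⁅Y, S⁆⁆ := by
    rw [lie_lie (K X) Y S, ← lie_skew Y ⁅K X, S⁆]; abel
  have j3 : ⁅⁅K Y, S⁆, X⁆ = ⁅⁅K Y, X⁆, S⁆ - ⁅K Y, ⁅X, S⁆⁆ := by
    rw [lie_lie (K Y) X S, ← lie_skew X ⁅K Y, S⁆]; abel
  have j4 : ⁅⁅K X, K Y⁆, S⁆ = ⁅K X, ⁅K Y, S⁆⁆ - ⁅K Y, ⁅K X, S⁆⁆ := lie_lie _ _ _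
  have k1 : ⁅K Y, X⁆ = -⁅X, K Y⁆ := (lie_skew _ _).symm
  have k2 : ⁅K Y, ⁅X, S⁆⁆ = -⁅⁅X, S⁆, K Y⁆ := (lie_skew _ _).symm
  have k3 : ⁅K Y, K ⁅X, S⁆⁆ = -⁅K ⁅X, S⁆, K Y⁆ := (lie_skew _ _).symm
  have k4 : ⁅K ⁅Y, S⁆, X⁆ = -⁅X, K ⁅Y, S⁆⁆ := (lie_skew _ _).symm
  simp only [fnBracket₂, hc, map_sub, lie_sub, sub_lie, add_lie, j1, j2, j3, j4, k1, k2, k3, k4,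
    map_neg, neg_lie] at h1 h2 h3 ⊢
  linear_combination (norm := abel) h1 - h2 - h3

end Algebra

/-- The value of a derivation along `φ` on a function. -/
def DerAlong.applyHom {A B : Type*} [CommRing A] [Algebra ℝ A] [CommRing B] [Algebra ℝ B]
    (φ : B →ₐ[ℝ] A) (b : B) : DerAlong φ →ₗ[A] A where
  toFun X := X.1 b
  map_add' _ _ := rfl
  map_smul' _ _ := rfl

theorem DerAlong.ext {A B : Type*} [CommRing A] [Algebra ℝ A] [CommRing B] [Algebra ℝ B]
    {φ : B →ₐ[ℝ] A} {X X' : DerAlong φ}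
    (h : ∀ b, DerAlong.applyHom φ b X = DerAlong.applyHom φ b X') : X = X' :=
  Subtype.ext (LinearMap.ext h)

/-! ### Coverings and the extended distribution -/

section Coverings

variable {n d e r : ℕ} {M Y E Q : Type*}
  [TopologicalSpace M] [ChartedSpace (EuclideanSpace ℝ (Fin n)) M]
  [TopologicalSpace Y] [ChartedSpace (EuclideanSpace ℝ (Fin d)) Y]
  [TopologicalSpace E] [ChartedSpace (EuclideanSpace ℝ (Fin e)) E]
  [TopologicalSpace Q] [ChartedSpace (EuclideanSpace ℝ (Fin r)) Q]
  {ζ : Y → M} {k : ℕ} {E₀ : Set (Jet n d ζ (k : ℕ∞))} {π : E → M}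
  {F : Connection (etaStar E₀ e π)}

theorem isPointDer_tauStar (Z : Derivation ℝ (PullbackFun E₀ e π) (PullbackFun E₀ e π))
    (q : Pullback E₀ π) :
    IsPointDer (eqnEv E₀) q.1.1 fun f => pullbackEv E₀ e π (Z (tauStar E₀ e π f)) q :=
  (IsPointDer.of_derivation Z q).comap (tauStar E₀ e π) fun _ => rfl

theorem vertical_tauStar_le :
    vertical (tauStar E₀ e π) ≤ extendedDistribution E₀ e π := by
  intro V hV q
  simp only [mem_vertical.1 hV]
  exact inCartanPlane_zero E₀ q.1.1

theorem lift_mem_extendedDistribution (hF : IsCovering E₀ e π F) (X : VF n M) :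
    F.lift X ∈ extendedDistribution E₀ e π := fun q => ⟨X, hF.2 X q⟩

/-- The fields from which the extended distribution is generated locally. -/
def localGenerators (F : Connection (etaStar E₀ e π)) :
    Set (Derivation ℝ (PullbackFun E₀ e π) (PullbackFun E₀ e π)) :=
  Set.range F.lift ∪ vertical (tauStar E₀ e π)

theorem localGenerators_subset (hF : IsCovering E₀ e π F) :
    localGenerators F ⊆ extendedDistribution E₀ e π := by
  rintro _ (⟨X, rfl⟩ | hV)
  exacts [lift_mem_extendedDistribution hF X, vertical_tauStar_le hV]

/-- Localization: at `q` one may divide by the value of `ρ`. The same applies to membership in the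
extended distribution, which is a pointwise linear condition. -/
theorem eq_of_forall_exists_smul_eq
    {Z W : Derivation ℝ (PullbackFun E₀ e π) (PullbackFun E₀ e π)}
    (h : ∀ q, ∃ ρ : PullbackFun E₀ e π, pullbackEv E₀ e π ρ q ≠ 0 ∧ ρ • Z = ρ • W) : Z = W := by
  refine Derivation.ext fun f => (isDifferentialSpace_pullbackEv E₀ e π).injective <|
    funext fun q => ?_
  obtain ⟨ρ, h0, hρ⟩ := h q
  have h1 := congrFun (congrArg (pullbackEv E₀ e π) (Derivation.congr_fun hρ f)) q
  simpa [h0] using h1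

theorem mem_extendedDistribution_of_smul_mem
    {Z : Derivation ℝ (PullbackFun E₀ e π) (PullbackFun E₀ e π)}
    (h : ∀ q, ∃ ρ : PullbackFun E₀ e π, pullbackEv E₀ e π ρ q ≠ 0 ∧
      ρ • Z ∈ extendedDistribution E₀ e π) : Z ∈ extendedDistribution E₀ e π := by
  intro q
  obtain ⟨ρ, h0, hρ⟩ := h q
  convert (hρ q).smul E₀ (pullbackEv E₀ e π ρ q)⁻¹ using 2 with f
  exact (inv_mul_cancel_left₀ h0 (pullbackEv E₀ e π (Z (tauStar E₀ e π f)) q)).symm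

/-- The derivative of a function on `𝓔` along a lifted field is constant along the fibres
of `τ`. -/
theorem lift_tauStar_apply_eq (hF : IsCovering E₀ e π F) (X : VF n M) (f : EqnFun E₀)
    {q q' : Pullback E₀ π} (h : q.1.1 = q'.1.1) :
    pullbackEv E₀ e π (F.lift X (tauStar E₀ e π f)) q =
      pullbackEv E₀ e π (F.lift X (tauStar E₀ e π f)) q' := by
  have h1 := isPointDer_tauStar (F.lift X) q
  have h2 := hF.2 X q
  rw [h] at h1 h2
  exact h2.apply_eq (hF.2 X q') (fun _ => rfl) h1 (isPointDer_tauStar (F.lift X) q') f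

/-- On `τ^* f` the bracket is `-V (F X (τ^* f))`, and `F X (τ^* f)` is constant along the fibres of
`τ`. -/
theorem lie_lift_mem_vertical (hπ : IsSmoothFiberBundle n e r Q π) (hF : IsCovering E₀ e π F)
    [IsManifold (𝓡 n) ∞ M] [T2Space M] (X : VF n M)
    {V : Derivation ℝ (PullbackFun E₀ e π) (PullbackFun E₀ e π)}
    (hV : V ∈ vertical (tauStar E₀ e π)) : ⁅F.lift X, V⁆ ∈ vertical (tauStar E₀ e π) := by
  rw [mem_vertical] at *
  intro f
  rw [Derivation.commutator_apply, hV, map_zero, zero_sub, neg_eq_zero]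
  exact apply_eq_zero_of_tau_vertical hπ hV fun q q' h => lift_tauStar_apply_eq hF X f h

variable [IsManifold (𝓡 n) ∞ M] [T2Space M]

theorem lie_mem_span_localGenerators (hπ : IsSmoothFiberBundle n e r Q π)
    (hF : IsCovering E₀ e π F)
    {Z W : Derivation ℝ (PullbackFun E₀ e π) (PullbackFun E₀ e π)}
    (hZ : Z ∈ Submodule.span (PullbackFun E₀ e π) (localGenerators F))
    (hW : W ∈ Submodule.span (PullbackFun E₀ e π) (localGenerators F)) :
    ⁅Z, W⁆ ∈ Submodule.span (PullbackFun E₀ e π) (localGenerators F) := by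
  refine lie_mem_span ?_ hZ hW
  rintro _ (⟨X, rfl⟩ | hV) _ (⟨X', rfl⟩ | hV') <;> refine Submodule.subset_span ?_
  · exact Or.inl ⟨_, (hF.1 X X').symm⟩
  · exact Or.inr (lie_lift_mem_vertical hπ hF X hV')
  · rw [← lie_skew]
    exact Or.inr (Submodule.neg_mem _ (lie_lift_mem_vertical hπ hF X' hV))
  · exact Or.inr (lie_mem_vertical hV hV')

/-- Locally, the derivations along `η : 𝓔' → M` are combinations of vector fields on `M`. -/
theorem exists_local_decomposition (q : Pullback E₀ π) :
    ∃ (ρ : PullbackFun E₀ e π) (h : Fin n → Smooth n M) (X : Fin n → VF n M),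
      pullbackEv E₀ e π ρ q ≠ 0 ∧ ∀ Z : DerAlong (etaStar E₀ e π),
        ρ • Z = ∑ i, (ρ * Z.1 (h i)) • pullDer (etaStar E₀ e π) (X i) := by
  obtain ⟨h, X, hX⟩ := exists_local_frame (n := n) q.1.1.1.base
  rw [← nearFilter_smoothEv (n := n), eventually_nearFilter] at hX
  obtain ⟨ρ, h0, hρ⟩ := hX
  refine ⟨etaStar E₀ e π ρ, h, X, h0, fun Z => DerAlong.ext fun f => ?_⟩
  refine (isDifferentialSpace_pullbackEv E₀ e π).injective <| funext fun q' => ?_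
  simp only [map_smul, map_sum, smul_eq_mul, map_mul, Pi.mul_apply, Finset.sum_apply]
  have hρ' : pullbackEv E₀ e π (etaStar E₀ e π ρ) q' = ρ q'.1.1.1.base := rfl
  by_cases hq : ρ q'.1.1.1.base = 0
  · simp [hρ', hq]
  · have h1 := hρ _ hq _ (IsPointDer.of_derAlong (ev := pullbackEv E₀ e π)
      (ev' := smoothEv n M) (x := q') (x' := q'.1.1.1.base) Z fun f => rfl) f
    change _ * pullbackEv E₀ e π (Z.1 f) q' = _
    rw [h1, Finset.mul_sum]
    exact Finset.sum_congr rfl fun i _ => (mul_assoc _ _ _).symm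

/-- Flatness and the covering condition speak only of lifts of fields on `M`; this extends their
reach to lifts of arbitrary derivations along `η`. -/
theorem exists_smul_toLin_mem (F : Connection (etaStar E₀ e π)) (q : Pullback E₀ π) :
    ∃ ρ : PullbackFun E₀ e π, pullbackEv E₀ e π ρ q ≠ 0 ∧
      ∀ Z, ρ • F.toLin Z ∈ Submodule.span (PullbackFun E₀ e π) (Set.range F.lift) := by
  obtain ⟨ρ, h, X, h0, hρ⟩ := exists_local_decomposition (E₀ := E₀) (e := e) q
  refine ⟨ρ, h0, fun Z => ?_⟩
  rw [← map_smul, hρ, map_sum]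
  refine Submodule.sum_mem _ fun i _ => ?_
  rw [map_smul]
  exact Submodule.smul_mem _ _ (Submodule.subset_span ⟨X i, rfl⟩)

theorem distribution_le_extendedDistribution (hF : IsCovering E₀ e π F) :
    F.distribution ≤ extendedDistribution E₀ e π := by
  rintro _ ⟨Z, rfl⟩
  refine mem_extendedDistribution_of_smul_mem fun q => ?_
  obtain ⟨ρ, h0, hρ⟩ := exists_smul_toLin_mem F q
  refine ⟨ρ, h0, Submodule.span_le.2 ?_ (hρ Z)⟩
  rintro _ ⟨X, rfl⟩
  exact lift_mem_extendedDistribution hF X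

/-- The fields of a flat connection are involutive. -/
theorem lie_mem_distribution (hF : F.IsFlat)
    {Z W : Derivation ℝ (PullbackFun E₀ e π) (PullbackFun E₀ e π)}
    (hZ : Z ∈ F.distribution) (hW : W ∈ F.distribution) : ⁅Z, W⁆ ∈ F.distribution := by
  -- Membership in the distribution is restated as an equation of fields, which can be checked after
  -- multiplication by a function.
  have key : F.formU ⁅Z, W⁆ = ⁅Z, W⁆ := by
    refine eq_of_forall_exists_smul_eq fun q => ?_
    obtain ⟨ρ, h0, hρ⟩ := exists_smul_toLin_mem F q
    have hle : Submodule.span (PullbackFun E₀ e π) (Set.range F.lift) ≤ F.distribution :=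
      Submodule.span_le.2 (by rintro _ ⟨X, rfl⟩; exact F.lift_mem X)
    have h1 : ⁅ρ • Z, ρ • W⁆ ∈ F.distribution := by
      refine hle (lie_mem_span ?_ ?_ ?_)
      · rintro _ ⟨X, rfl⟩ _ ⟨X', rfl⟩
        exact Submodule.subset_span ⟨_, (hF X X').symm⟩
      · obtain ⟨Z', rfl⟩ := hZ
        exact hρ Z'
      · obtain ⟨W', rfl⟩ := hW
        exact hρ W'
    have h2 : (ρ * ρ) • ⁅Z, W⁆ ∈ F.distribution := by
      have h3 : (ρ * ρ) • ⁅Z, W⁆ = ⁅ρ • Z, ρ • W⁆ - (ρ * Z ρ) • W + (ρ * W ρ) • Z := by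
        rw [lie_smul_derivation, smul_lie_derivation, smul_sub, smul_smul, smul_smul,
          Derivation.smul_apply, smul_eq_mul]
        abel
      rw [h3]
      exact add_mem (sub_mem h1 (Submodule.smul_mem _ _ hW)) (Submodule.smul_mem _ _ hZ)
    refine ⟨ρ * ρ, by simpa using h0, ?_⟩
    rw [← map_smul, F.formU_eq_self h2]
  rw [← key]
  exact F.formU_mem _

/-- A field of the extended distribution is determined on the functions on `𝓔` by its projection
to `M`. -/
theorem apply_tauStar_eq {Z W : Derivation ℝ (PullbackFun E₀ e π) (PullbackFun E₀ e π)}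
    (hZ : Z ∈ extendedDistribution E₀ e π) (hW : W ∈ extendedDistribution E₀ e π)
    (h : ∀ f, Z (etaStar E₀ e π f) = W (etaStar E₀ e π f)) (f : EqnFun E₀) :
    Z (tauStar E₀ e π f) = W (tauStar E₀ e π f) := by
  refine (isDifferentialSpace_pullbackEv E₀ e π).injective <| funext fun q => ?_
  obtain ⟨X, hX⟩ := hZ q
  obtain ⟨X', hX'⟩ := hW q
  refine hX.apply_eq hX' (fun b => ?_) (isPointDer_tauStar Z q) (isPointDer_tauStar W q) f
  rw [← hX.apply_xiStar, ← hX'.apply_xiStar]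
  exact congrArg (fun g : PullbackFun E₀ e π => g.1 q) (h b)

/-- Agreement on `E` includes agreement on `M`, which fixes the Cartan vector and with it the action
on functions on `𝓔`. -/
theorem eq_of_mem_extendedDistribution (hπ : IsSmoothFiberBundle n e r Q π)
    {Z W : Derivation ℝ (PullbackFun E₀ e π) (PullbackFun E₀ e π)}
    (hZ : Z ∈ extendedDistribution E₀ e π) (hW : W ∈ extendedDistribution E₀ e π)
    (h : ∀ g, Z (xiStar' E₀ e π g) = W (xiStar' E₀ e π g)) : Z = W :=
  derivation_ext (apply_tauStar_eq hZ hW fun f => by rw [etaStar_eq hπ.1, h]) h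

/-- `Z` and `Ū_F Z` both lie in the extended distribution and project equally to `M`, so their
difference is `τ`-vertical; `Ū_F Z` is locally a combination of lifts. -/
theorem exists_smul_mem_span_localGenerators (hF : IsCovering E₀ e π F) (q : Pullback E₀ π) :
    ∃ ρ : PullbackFun E₀ e π, pullbackEv E₀ e π ρ q ≠ 0 ∧
      ∀ Z ∈ extendedDistribution E₀ e π, ρ • Z ∈ Submodule.span (PullbackFun E₀ e π) (localGenerators F) := by
  obtain ⟨ρ, h0, hρ⟩ := exists_smul_toLin_mem F q
  refine ⟨ρ, h0, fun Z hZ => ?_⟩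
  have h1 : Z - F.formU Z ∈ vertical (tauStar E₀ e π) := mem_vertical.2 fun f => by
    rw [Derivation.sub_apply, sub_eq_zero]
    exact apply_tauStar_eq hZ (distribution_le_extendedDistribution hF (F.formU_mem Z))
      (fun f => (F.formU_apply_base Z f).symm) f
  rw [← sub_add_cancel Z (F.formU Z), smul_add]
  exact add_mem (Submodule.smul_mem _ _ (Submodule.subset_span (Or.inr h1)))
    (Submodule.span_mono Set.subset_union_left (hρ _))

theorem lie_mem_extendedDistribution (hπ : IsSmoothFiberBundle n e r Q π)
    (hF : IsCovering E₀ e π F)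
    {Z W : Derivation ℝ (PullbackFun E₀ e π) (PullbackFun E₀ e π)}
    (hZ : Z ∈ extendedDistribution E₀ e π) (hW : W ∈ extendedDistribution E₀ e π) :
    ⁅Z, W⁆ ∈ extendedDistribution E₀ e π := by
  refine mem_extendedDistribution_of_smul_mem fun q => ?_
  obtain ⟨ρ, h0, hρ⟩ := exists_smul_mem_span_localGenerators hF q
  have h1 := Submodule.span_le.2 (localGenerators_subset hF)
    (lie_mem_span_localGenerators hπ hF (hρ Z hZ) (hρ W hW))
  refine ⟨ρ * ρ, by simpa using h0, ?_⟩
  have h3 : (ρ * ρ) • ⁅Z, W⁆ = ⁅ρ • Z, ρ • W⁆ - (ρ * Z ρ) • W + (ρ * W ρ) • Z := by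
    rw [lie_smul_derivation, smul_lie_derivation, smul_sub, smul_smul, smul_smul,
      Derivation.smul_apply, smul_eq_mul]
    abel
  rw [h3]
  exact add_mem (sub_mem h1 (Submodule.smul_mem _ _ hW)) (Submodule.smul_mem _ _ hZ)

/-- When `𝓔'` is not empty, the Cartan lifts of the vector fields on `M` are vector fields
on `𝓔`. -/
theorem exists_cartanLift (hπ : IsSmoothFiberBundle n e r Q π) (hF : IsCovering E₀ e π F)
    (q₀ : Pullback E₀ π) (X : VF n M) : ∃ C ∈ cartanDistribution E₀,
      ∀ f, F.lift X (tauStar E₀ e π f) = tauStar E₀ e π (C f) := by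
  have : Nonempty E := ⟨q₀.1.2⟩
  choose σ hσ using hπ.surjective
  let t : Eqn E₀ → Pullback E₀ π := fun θ => ⟨(θ, σ θ.1.base), (hσ _).symm⟩
  choose C hC using fun f => exists_tauStar_eq hπ q₀ fun q q' h =>
    lift_tauStar_apply_eq hF X f h
  have hev : ∀ f θ, eqnEv E₀ (C f) θ =
      pullbackEv E₀ e π (F.lift X (tauStar E₀ e π f)) (t θ) := fun f θ => by rw [← hC]; rfl
  obtain ⟨Z, hZ⟩ := (isDifferentialSpace_eqnEv E₀).exists_derivation
    (fun θ => isPointDer_tauStar (F.lift X) (t θ))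
    (fun f θ => ⟨C f, Filter.Eventually.of_forall fun θ' => (hev f θ').symm⟩)
  have hZC : ∀ f, Z f = C f := fun f => (isDifferentialSpace_eqnEv E₀).injective <|
    funext fun θ => (hZ f θ).trans (hev f θ).symm
  refine ⟨Z, fun θ => ⟨X, ?_⟩, fun f => by rw [hZC, hC]⟩
  convert hF.2 X (t θ) using 2 with f
  exact hZ f θ

/-- On local generators: `[T, F X]` projects to `[S, 𝒞X]`, which is Cartan because `S` is a
symmetry, and `[T, V]` is `τ`-vertical because `T` preserves the functions pulled back from `𝓔`. The
point `q₀` makes `𝓔'` nonempty, as needed for `𝒞X` to be a field on `𝓔`. -/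
theorem IsHat.lie_mem (hπ : IsSmoothFiberBundle n e r Q π) (hF : IsCovering E₀ e π F)
    {S : Derivation ℝ (EqnFun E₀) (EqnFun E₀)}
    (hS : IsSymmetry (xiStar E₀) (cartanDistribution E₀) S)
    {T : Derivation ℝ (PullbackFun E₀ e π) (PullbackFun E₀ e π)} (hT : IsHat (e := e) E₀ π S T)
    {W : Derivation ℝ (PullbackFun E₀ e π) (PullbackFun E₀ e π)}
    (hW : W ∈ extendedDistribution E₀ e π) : ⁅T, W⁆ ∈ extendedDistribution E₀ e π := by
  refine mem_extendedDistribution_of_smul_mem fun q₀ => ?_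
  obtain ⟨ρ, h0, hρ⟩ := exists_smul_mem_span_localGenerators hF q₀
  refine ⟨ρ, h0, ?_⟩
  have h1 : ⁅T, ρ • W⁆ ∈ extendedDistribution E₀ e π := by
    refine lie_mem_of_mem_span (localGenerators_subset hF) ?_ (hρ W hW)
    rintro _ (⟨X, rfl⟩ | hV)
    · obtain ⟨C, hC, h⟩ := exists_cartanLift hπ hF q₀ X
      intro q
      convert hS.2 C hC q.1.1 using 2 with f
      have h2 : ⁅T, F.lift X⁆ (tauStar E₀ e π f) = tauStar E₀ e π (⁅S, C⁆ f) := by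
        rw [Derivation.commutator_apply, Derivation.commutator_apply, h, hT.2, hT.2, h, map_sub]
      rw [h2]
      rfl
    · refine vertical_tauStar_le (mem_vertical.2 fun f => ?_)
      rw [Derivation.commutator_apply, hT.2, mem_vertical.1 hV, mem_vertical.1 hV, map_zero,
        sub_zero]
  rw [lie_smul_derivation] at h1
  simpa using sub_mem h1 (Submodule.smul_mem _ (T ρ) hW)

theorem existsUnique_isHat (hπ : IsSmoothFiberBundle n e r Q π)
    {S : Derivation ℝ (EqnFun E₀) (EqnFun E₀)} (hS : S ∈ vertical (xiStar E₀)) :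
    ∃! T, IsHat (e := e) E₀ π S T := by
  obtain ⟨T, h1, h2⟩ := exists_isHat hπ (mem_vertical.1 hS)
  refine ⟨T, ⟨mem_vertical.2 h2, h1⟩, fun T' hT' => derivation_ext (fun f => ?_) fun b => ?_⟩
  · rw [hT'.2, h1]
  · rw [mem_vertical.1 hT'.1, h2]

/-- By involutivity both sides lie in the extended distribution, and they act alike on functions on
`E`. -/
theorem isFlat_of_distribution_eq (hπ : IsSmoothFiberBundle n e r Q π)
    (hF : IsCovering E₀ e π F) {C₁ : Connection (xiStar' E₀ e π)}
    (hC : C₁.distribution = extendedDistribution E₀ e π) : C₁.IsFlat := by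
  intro X X'
  have h : ∀ X, C₁.lift X ∈ extendedDistribution E₀ e π := fun X => hC ▸ C₁.lift_mem X
  refine eq_of_mem_extendedDistribution hπ (lie_mem_extendedDistribution hπ hF (h X) (h X')) (h _)
    fun g => ?_
  rw [Derivation.commutator_apply, C₁.lift_apply, C₁.lift_apply, C₁.lift_apply, C₁.lift_apply,
    C₁.lift_apply, Derivation.commutator_apply, map_sub]

/-! ### Existence and uniqueness of the connection over `E` -/

variable [IsManifold (𝓡 e) ∞ E] [T2Space E] [IsManifold (𝓡 r) ∞ Q]

theorem bijective_restr_extendedDistribution (hπ : IsSmoothFiberBundle n e r Q π)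
    (hF : IsCovering E₀ e π F) : Function.Bijective
      ((restr (xiStar' E₀ e π)).domRestrict (extendedDistribution E₀ e π)) := by
  refine ⟨fun Z W h => Subtype.ext (eq_of_mem_extendedDistribution hπ Z.2 W.2 fun g => ?_),
    fun D => ?_⟩
  · exact congrArg (DerAlong.applyHom _ g) h
  · let D₀ : DerAlong (etaStar E₀ e π) := ⟨D.1 ∘ₗ (pullbackHom hπ.1).toLinearMap, fun f g => by
      have := D.2 (pullbackHom hπ.1 f) (pullbackHom hπ.1 g)
      rw [← map_mul, ← etaStar_eq, ← etaStar_eq] at this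
      exact this⟩
    obtain ⟨Z, hZ, hZD⟩ := exists_vertical_extension hπ
      (D := D - restr (xiStar' E₀ e π) (F.toLin D₀)) (fun h => by
        have h1 : F.toLin D₀ (etaStar E₀ e π h) = D.1 (pullbackHom hπ.1 h) :=
          congrArg (DerAlong.applyHom _ h) (F.restr_toLin D₀)
        rw [etaStar_eq hπ.1] at h1
        exact sub_eq_zero.2 h1.symm)
    refine ⟨⟨F.toLin D₀ + Z, add_mem (distribution_le_extendedDistribution hF ⟨D₀, rfl⟩)
      (vertical_tauStar_le (mem_vertical.2 hZ))⟩, DerAlong.ext fun b => ?_⟩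
    exact (congrArg (F.toLin D₀ (xiStar' E₀ e π b) + ·) (hZD b)).trans
      (add_sub_cancel (F.toLin D₀ (xiStar' E₀ e π b)) (DerAlong.applyHom _ b D))

/-- A connection with this distribution is a right inverse of the bijective restriction map with
values in the distribution, hence the inverse. -/
theorem existsUnique_extendedConnection (hπ : IsSmoothFiberBundle n e r Q π)
    (hF : IsCovering E₀ e π F) : ∃! C₁ : Connection (xiStar' E₀ e π),
      C₁.distribution = extendedDistribution E₀ e π := by
  let ε := LinearEquiv.ofBijective _ (bijective_restr_extendedDistribution hπ hF)
  refine ⟨⟨(extendedDistribution E₀ e π).subtype ∘ₗ ε.symm.toLinearMap,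
    fun X => ε.apply_symm_apply X⟩, ?_, fun C hC => ?_⟩
  · change LinearMap.range _ = _
    rw [LinearMap.range_comp, LinearEquiv.range, Submodule.map_top, Submodule.range_subtype]
  · have h : C.toLin = (extendedDistribution E₀ e π).subtype ∘ₗ ε.symm.toLinearMap := by
      refine LinearMap.ext fun X => ?_
      have h1 : C.toLin X ∈ extendedDistribution E₀ e π := hC ▸ ⟨X, rfl⟩
      refine congrArg Subtype.val (?_ : (⟨C.toLin X, h1⟩ : extendedDistribution E₀ e π) = _)
      exact (ε.symm_apply_eq.2 (C.restr_toLin X).symm).symm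
    cases C
    congr

end Coverings

end FlatRep

/-! ### The theorem -/

theorem theorem5p1 {n d e m r : ℕ} {M Y E P Q : Type*}
    [TopologicalSpace M] [ChartedSpace (EuclideanSpace ℝ (Fin n)) M] [IsManifold (𝓡 n) ∞ M]
    [T2Space M] [SecondCountableTopology M]
    [TopologicalSpace Y] [ChartedSpace (EuclideanSpace ℝ (Fin d)) Y] [IsManifold (𝓡 d) ∞ Y]
    [T2Space Y] [SecondCountableTopology Y]
    [TopologicalSpace E] [ChartedSpace (EuclideanSpace ℝ (Fin e)) E] [IsManifold (𝓡 e) ∞ E]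
    [T2Space E] [SecondCountableTopology E]
    [TopologicalSpace P] [ChartedSpace (EuclideanSpace ℝ (Fin m)) P] [IsManifold (𝓡 m) ∞ P]
    [T2Space P] [SecondCountableTopology P]
    [TopologicalSpace Q] [ChartedSpace (EuclideanSpace ℝ (Fin r)) Q] [IsManifold (𝓡 r) ∞ Q]
    [T2Space Q] [SecondCountableTopology Q]
    -- the bundle whose sections are the unknowns, and the differential equation
    (ζ : Y → M) (hζ : IsSmoothFiberBundle n d m P ζ)
    {k : ℕ} (E₀ : Set (Jet n d ζ (k : ℕ∞)))
    -- the bundle of the covering, and the covering structure in its pullback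
    (π : E → M) (hπ : IsSmoothFiberBundle n e r Q π)
    (F : Connection (etaStar E₀ e π)) (hF : IsCovering E₀ e π F) :
    -- the extended distribution is that of a unique connection over `E`
    (∃! C₁ : Connection (xiStar' E₀ e π), C₁.distribution = extendedDistribution E₀ e π) ∧
    ∀ C₁ : Connection (xiStar' E₀ e π), C₁.distribution = extendedDistribution E₀ e π →
      C₁.IsFlat ∧ IsFlatRepresentation C₁.distribution F ∧
      ∀ S : Derivation ℝ (EqnFun E₀) (EqnFun E₀),
        IsSymmetry (xiStar E₀) (cartanDistribution E₀) S →
        (∃! T, IsHat (e := e) E₀ π S T) ∧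
        ∀ T, IsHat (e := e) E₀ π S T →
          IsSymmetry (xiStar' E₀ e π) C₁.distribution T ∧
          IsOneCocycle C₁.distribution F (symCocycle F T) ∧
          (IsExact C₁.distribution F (symCocycle F T) ↔
            ∃ S', IsSymmetry (etaStar E₀ e π) F.distribution S' ∧ ProjectsTo E₀ π S' S) := by
  refine ⟨existsUnique_extendedConnection hπ hF, fun C₁ hC =>
    ⟨isFlat_of_distribution_eq hπ hF hC, ⟨hF.1, fun X => ?_⟩, fun S hS =>
      ⟨existsUnique_isHat hπ hS.1, fun T hT => ?_⟩⟩⟩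
  · rw [hC]
    exact lift_mem_extendedDistribution hF X
  have hTv : T ∈ vertical (etaStar E₀ e π) := mem_vertical.2 fun h => by
    rw [etaStar_eq hπ.1, mem_vertical.1 hT.1]
  rw [hC]
  refine ⟨⟨hT.1, fun W hW => hT.lie_mem hπ hF hS hW⟩, ⟨⟨fun Z => ⟨F.symCocycle_mem_vertical hTv Z,
    ?_⟩, fun Z hZ => F.symCocycle_eq_zero hTv hZ⟩, fun X X' => ?_⟩, ?_, ?_⟩
  · refine sub_mem ?_ (distribution_le_extendedDistribution hF (F.formU_mem _))
    rw [← lie_skew]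
    exact neg_mem (hT.lie_mem hπ hF hS (distribution_le_extendedDistribution hF (F.formU_mem Z)))
  -- The torsion of the projector `U = Ū_F` vanishes: `U [X - U X, Y - U Y] = 0` because vertical
  -- fields are closed under the bracket, and `[U X, U Y]` is horizontal by flatness.
  · refine fnBracket₂_fnBracket F.formU (fun X Y => ?_) T X X'
    have hUU : ∀ Z, F.formU (F.formU Z) = F.formU Z := fun Z => F.formU_eq_self (F.formU_mem Z)
    have h1 := F.formU_eq_zero (lie_mem_vertical (F.sub_formU_mem X) (F.sub_formU_mem Y))
    have h2 := F.formU_eq_self (lie_mem_distribution hF.1 (F.formU_mem X) (F.formU_mem Y))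
    simp only [lie_sub, sub_lie, map_sub, h2] at h1
    rw [hUU]
    linear_combination (norm := abel) h1
  · rintro ⟨V, hV, hc⟩
    refine ⟨T - V, F.isSymmetry_iff.2 ⟨sub_mem hTv hV.1, ?_⟩, fun f => ?_⟩
    · rw [symCocycle, fnBracket_sub, sub_eq_zero]
      exact hc
    -- `V` and the zero field lie in the extended distribution and have the same projection to `M`,
    -- so `V` is `τ`-vertical and `T - V` still projects to `S`.
    · have h1 : V (tauStar E₀ e π f) = (0 : Derivation ℝ _ (PullbackFun E₀ e π)) _ :=
        apply_tauStar_eq hV.2 (zero_mem _) (fun h => mem_vertical.1 hV.1 h) f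
      rw [Derivation.sub_apply, h1, Derivation.zero_apply, sub_zero, hT.2]
  · rintro ⟨S', hS', hSS'⟩
    -- Two lifts of `S` differ by a `τ`-vertical field, which belongs to `𝒱`.
    refine ⟨T - S', ⟨sub_mem hTv hS'.1, vertical_tauStar_le (mem_vertical.2 fun f => ?_)⟩, ?_⟩
    · rw [Derivation.sub_apply, hT.2, hSS', sub_self]
    · have h1 : fnBracket F.formU S' = 0 := (F.isSymmetry_iff.1 hS').2
      rw [fnBracket_sub, h1, sub_zero, symCocycle]
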